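/- An $\mathsf{Fset}(\mathbb Z)$-category $C$ is a small category $\underline C$ in which every morphism $f$ has a degree $\deg f\in\mathbb Z_{\ge 0}$ such that $\deg \mathrm{id}=0$ and $\deg(g\circ f)\le\deg g+\deg f$. For $n\ge 0$ let $\mathsf{FC}_nC$ be the free abelian group on the composable strings $(f_1,\dots,f_n)$ of morphisms (on the objects if $n=0$), with $\partial=\sum_i(-1)^id_i$ the alternating sum of the face maps of the nerve of $\underline C$, and for $p\in\mathbb Z$ let $F_p=(\mathsf{FC}_\bullet C)_p$ be the subcomplex spanned by the strings with $\sum_i\deg f_i\le p$. The un-normalized magnitude chain complex is $\widetilde{\mathrm{MC}}{}^{\ell}_\bullet C=(\mathsf{FC}_\bullet C)_\ell/(\mathsf{FC}_\bullet C)_{<\ell}$, the magnitude chain complex $\mathrm{MC}^\ell_\bullet C$ is its quotient by the strings that contain an identity morphism (both are zero for $\ell<0$), and $\mathrm{MH}^\ell_\bullet C=H_\bullet(\mathrm{MC}^\ell_\bullet C)$. Let $(E^r,d^r)_{r\ge0}$ be the spectral sequence of the filtered complex $\mathsf{FC}_\bullet C$: with $Z^r_p=\{x\in F_p \mid \partial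 x\in F_{p-r}\}$, $$E^r_{p,q}=Z^r_p/(Z^{r-1}_{p-1}+\partial Z^{r-1}_{p+r-1})\quad\text{in total degree } n=p+q,$$ the differential $d^r:E^r_{p,q}\to E^r_{p-r,q+r-1}$ is induced by $\partial$, and $E^\infty_{p,q}$ is the quotient of $\bigcap_rZ^r_p$ by its intersection with the subgroup $\sum_r(Z^{r-1}_{p-1}+\partial Z^{r-1}_{p+r-1})$. Let $C$ be an $\mathsf{Fset}(\mathbb Z)$-category. Then $d^r\circ d^r=0$, $E^{r+1}\cong H(E^r,d^r)$, and the following hold, all isomorphisms being the ones that send the class of a chain to its class, where this makes sense. 1. $E^0_{p,q}\cong\widetilde{\mathrm{MC}}{}^{p}_{p+q}C$, with $d^0$ corresponding to the differential of $\widetilde{\mathrm{MC}}{}^{p}_\bullet C$, and $E^1_{p,q}\cong\mathrm{MH}^p_{p+q}C$. 2. Let $G=(V,E)$ be a digraph without loops, and let $C$ be the $\mathsf{Fset}(\mathbb Z)$-category with set of objects $V$ and exactly one morphism $a\to b$, of degree $d(a,b)$, whenever the directed path metric $d(a,b)$ is finite, and none otherwise. Then $E^2_{p,0}\cong H_p(G)$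 for every $p\ge0$, where $H_\bullet(G)$ is the (regular, integral) path homology of Grigor'yan–Lin–Muranov–Yau, that is, the homology of the complex $\Omega_\bullet$ of $\partial$-invariant allowed paths. Consequently $E^2_{p,0}\cong\widetilde H_p(G)$ for every $p\ge1$, where $\widetilde H_\bullet(G)$ is the reduced path homology, that is, the homology of the augmented complex $0\leftarrow\mathbb Z\leftarrow\Omega_0\leftarrow\Omega_1\leftarrow\cdots$; and $\widetilde H_0(G)$ is isomorphic to the kernel of the augmentation $E^2_{0,0}\to\mathbb Z$ that sends the class of every vertex to $1$. 3. The spectral sequence converges to the homology $H_\bullet(\underline C)$ of the underlying small category (the integral homology of its nerve). That is, with $F_pH_n\subseteq H_n(\underline C)$ the image of the cycles in $F_p$, we have $F_pH_n=0$ for $p<0$, $\bigcup_pF_pH_n=H_n(\underline C)$, and $E^\infty_{p,q}\cong F_pH_{p+q}/F_{p-1}H_{p+q}$. Moreover, if for some $p,q,r_0$ all differentials $d^r$ with $r\ge r_0$ into and out of $E^r_{p,q}$ vanish, then $E^r_{p,q}\cong F_pH_{p+q}/F_{p-1}H_{p+q}$ for all $r\ge r_0$. If the degrees of the morphisms of $C$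 are bounded, then for every $n$ the filtration of $H_n(\underline C)$ is finite and there is an $r_0$ such that all these differentials vanish for all $r\ge r_0$ and all $p,q$ with $p+q=n$; in particular $E^r_{p,q}\cong F_pH_n/F_{p-1}H_n$ for these $r,p,q$. -/

import Mathlib

open CategoryTheory Opposite Simplicial
open scoped NNReal ENNReal

universe u v w

noncomputable section

/-! ### Categories enriched in filtered sets -/

/-- A category enriched over the monoidal category of `ℝ≥0`-filtered sets, given by its underlying
small category together with an exhaustive ascending filtration on each set of morphisms.
Identities are filtered maps out of the unit (one point of degree `0`) and composition is a
filtered map out of the product filtration `(X × Y)_ℓ = ⋃_{ℓ' + ℓ'' = ℓ} X_ℓ' × Y_ℓ''`. -/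
class FsetCategory (C : Type u) extends Category.{v} C where
  fil (a b : C) : ℝ≥0 → Set (a ⟶ b)
  fil_mono (a b : C) : Monotone (fil a b)
  fil_exhaustive {a b : C} (f : a ⟶ b) : ∃ ℓ, f ∈ fil a b ℓ
  id_mem (a : C) : 𝟙 a ∈ fil a a 0
  comp_mem {a b c : C} {f : a ⟶ b} {g : b ⟶ c} {ℓ ℓ' : ℝ≥0} :
    f ∈ fil a b ℓ → g ∈ fil b c ℓ' → f ≫ g ∈ fil a c (ℓ + ℓ')

namespace FsetCategory

/-- `deg f = ℓ`. -/
def HasDegree {C : Type u} [FsetCategory.{u, v} C] {a b : C} (f : a ⟶ b) (ℓ : ℝ≥0) : Prop :=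
  f ∈ fil a b ℓ ∧ ∀ ℓ' < ℓ, f ∉ fil a b ℓ'

/-- `C` is an `Fset(ℤ)`-category: every morphism has a degree, and it is a nonnegative integer. -/
def IsIntegral (C : Type u) [FsetCategory.{u, v} C] : Prop :=
  ∀ (a b : C) (f : a ⟶ b), ∃ n : ℕ, HasDegree f (n : ℝ≥0)

/-- The degrees of the morphisms of `C` are bounded. -/
def HasBoundedDegrees (C : Type u) [FsetCategory.{u, v} C] : Prop :=
  ∃ M : ℝ≥0, ∀ (a b : C) (f : a ⟶ b), f ∈ fil a b M

end FsetCategory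

/-! ### Simplicial chains -/

/-- The free abelian group functor `X ↦ ℤX`. -/
def freeAb : Type w ⥤ AddCommGrpCat.{w} where
  obj X := AddCommGrpCat.of (X →₀ ℤ)
  map f := AddCommGrpCat.ofHom (Finsupp.mapDomain.addMonoidHom f)
  map_id X := by
    ext : 1
    exact Finsupp.mapDomain.addMonoidHom_id
  map_comp f g := by
    ext : 1
    exact Finsupp.mapDomain.addMonoidHom_comp g f

/-- The chain complex `ℤX_0 ← ℤX_1 ← ⋯` of a simplicial set, with `∂ = ∑ (-1)^i d_i`. -/
def simplicialChains : SSet.{w} ⥤ ChainComplex AddCommGrpCat.{w} ℕ :=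
  (SimplicialObject.whiskering _ _).obj freeAb ⋙
    AlgebraicTopology.alternatingFaceMapComplex _

/-- A simplex as a generator of the chain group. -/
def simplexChain {X : SSet.{w}} {n : ℕ} (s : X _⦋n⦌) : (simplicialChains.obj X).X n :=
  (Finsupp.single s 1 : (X _⦋n⦌) →₀ ℤ)

/-- The subgroup of the `n`-chains generated by a set of `n`-simplices. -/
def chainSpan {X : SSet.{w}} {n : ℕ} (S : Set (X _⦋n⦌)) :
    AddSubgroup ((simplicialChains.obj X).X n) :=
  AddSubgroup.closure (simplexChain '' S)

theorem simplicialChains_d {X : SSet.{w}} {n : ℕ} (s : X _⦋n + 1⦌) :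
    ((simplicialChains.obj X).d (n + 1) n).hom (simplexChain s) =
      ∑ i : Fin (n + 2), (-1 : ℤ) ^ (i : ℕ) • simplexChain (X.δ i s) := by
  have h : (simplicialChains.obj X).d (n + 1) n =
      ∑ i : Fin (n + 2), (-1 : ℤ) ^ (i : ℕ) •
        (((SimplicialObject.whiskering _ _).obj freeAb).obj X).δ i :=
    AlgebraicTopology.alternatingFaceMapComplex_obj_d _ n
  let Y : SimplicialObject AddCommGrpCat.{w} :=
    ((SimplicialObject.whiskering _ _).obj freeAb).obj X
  have e : ∀ y : Y _⦋n + 1⦌, (∑ i : Fin (n + 2), (-1 : ℤ) ^ (i : ℕ) • Y.δ i).hom y =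
      ∑ i : Fin (n + 2), (-1 : ℤ) ^ (i : ℕ) • (Y.δ i).hom y := by
    intro y
    have h1 := map_sum (AddCommGrpCat.homAddEquiv (M := Y _⦋n + 1⦌) (N := Y _⦋n⦌))
      (fun i : Fin (n + 2) => (-1 : ℤ) ^ (i : ℕ) • Y.δ i) Finset.univ
    refine (DFunLike.congr_fun h1 y).trans ((AddMonoidHom.finsetSum_apply _ _ _).trans ?_)
    refine Finset.sum_congr rfl fun i _ => ?_
    rw [map_zsmul]
    rfl
  refine (congrArg (fun g => AddCommGrpCat.Hom.hom g (simplexChain s)) h).trans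
    ((e (simplexChain s)).trans ?_)
  refine Finset.sum_congr rfl fun i _ => ?_
  refine congrArg (fun y : (simplicialChains.obj X).X n => (-1 : ℤ) ^ (i : ℕ) • y) ?_
  exact Finsupp.mapDomain_single

/-- To check that the boundary preserves subgroups spanned by simplices, up to a given subgroup,
it suffices to look at simplices. -/
theorem chainSpan_d_le {X : SSet.{w}} (S : ∀ n, Set (X _⦋n⦌))
    (T : ∀ n, AddSubgroup ((simplicialChains.obj X).X n))
    (h : ∀ n, ∀ s ∈ S (n + 1),
      ((simplicialChains.obj X).d (n + 1) n).hom (simplexChain s) ∈ T n) (m n : ℕ) :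
    chainSpan (S m) ≤ (T n).comap ((simplicialChains.obj X).d m n).hom := by
  by_cases hmn : n + 1 = m
  · subst hmn
    refine (AddSubgroup.closure_le _).2 ?_
    rintro _ ⟨s, hs, rfl⟩
    exact h n s hs
  · intro x _
    have h0 : (simplicialChains.obj X).d m n = 0 := (simplicialChains.obj X).shape m n hmn
    rw [AddSubgroup.mem_comap, h0]
    exact (T n).zero_mem

theorem chainSpan_d_le_of_face {X : SSet.{w}} (S : ∀ n, Set (X _⦋n⦌))
    (h : ∀ n, ∀ s ∈ S (n + 1), ∀ i : Fin (n + 2), X.δ i s ∈ S n) (m n : ℕ) :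
    chainSpan (S m) ≤ (chainSpan (S n)).comap ((simplicialChains.obj X).d m n).hom := by
  refine chainSpan_d_le S (fun n => chainSpan (S n)) (fun n s hs => ?_) m n
  rw [simplicialChains_d]
  exact AddSubgroup.sum_mem _ fun i _ =>
    zsmul_mem (AddSubgroup.subset_closure (Set.mem_image_of_mem _ (h n s hs i))) _

/-- The subgroup of the chains generated by the degenerate simplices. -/
def degenerateChains (X : SSet.{w}) (n : ℕ) : AddSubgroup ((simplicialChains.obj X).X n) :=
  chainSpan (X.degenerate n)

theorem degenerateChains_d (X : SSet.{w}) (m n : ℕ) :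
    degenerateChains X m ≤
      (degenerateChains X n).comap ((simplicialChains.obj X).d m n).hom := by
  refine chainSpan_d_le _ _ (fun n s hs => ?_) m n
  rw [SSet.degenerate_eq_iUnion_range_σ, Set.mem_iUnion] at hs
  obtain ⟨j, t, rfl⟩ := hs
  rw [simplicialChains_d]
  have key : ∀ i : Fin (n + 2), i ≠ j.castSucc → i ≠ j.succ →
      X.δ i (X.σ j t) ∈ X.degenerate n := by
    intro i h1 h2
    obtain _ | n := n
    · exfalso
      have := i.isLt
      have := j.isLt
      simp only [ne_eq, Fin.ext_iff, Fin.val_castSucc, Fin.val_succ] at h1 h2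
      omega
    · rcases lt_or_gt_of_ne h1 with h | h
      · obtain ⟨j, rfl⟩ := Fin.eq_succ_of_ne_zero (i := j) (by
          rintro rfl
          simp at h)
        obtain ⟨i, rfl⟩ := Fin.eq_castSucc_of_ne_last (x := i) (by
          rintro rfl
          exact absurd h (not_lt.2 (Fin.le_last _)))
        rw [SSet.δ_comp_σ_of_le_apply (by
          simp only [Fin.lt_def, Fin.le_def, Fin.val_castSucc, Fin.val_succ] at h ⊢
          omega)]
        exact SSet.σ_mem_degenerate _ _ _
      · rw [SSet.δ_comp_σ_of_gt'_apply (by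
          simp only [ne_eq, Fin.ext_iff, Fin.lt_def, Fin.val_castSucc,
            Fin.val_succ] at h h2 ⊢
          omega)]
        exact SSet.σ_mem_degenerate _ _ _
  have hne : j.castSucc ≠ j.succ := by
    simp [Fin.ext_iff]
  rw [← Finset.add_sum_erase _ _ (Finset.mem_univ j.castSucc),
    ← Finset.add_sum_erase _ _ (Finset.mem_erase.2 ⟨hne.symm, Finset.mem_univ j.succ⟩),
    SSet.δ_comp_σ_self_apply, SSet.δ_comp_σ_succ_apply, ← add_assoc, ← add_zsmul]
  have h0 : (-1 : ℤ) ^ (j.castSucc : ℕ) + (-1 : ℤ) ^ (j.succ : ℕ) = 0 := by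
    rw [Fin.val_castSucc, Fin.val_succ, pow_succ]
    ring
  rw [h0, zero_zsmul, zero_add]
  refine AddSubgroup.sum_mem _ fun i hi => ?_
  simp only [Finset.mem_erase, Finset.mem_univ, and_true] at hi
  exact zsmul_mem (AddSubgroup.subset_closure (Set.mem_image_of_mem _ (key i hi.2 hi.1))) _

/-- The map `A/(A ∩ B) → A'/(A' ∩ B')` between subquotients that is induced by `f`. -/
def subquotientMap {M N : Type*} [AddCommGroup M] [AddCommGroup N] (f : M →+ N)
    {A B : AddSubgroup M} {A' B' : AddSubgroup N} (hA : A ≤ A'.comap f) (hB : B ≤ B'.comap f) :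
    A ⧸ B.addSubgroupOf A →+ A' ⧸ B'.addSubgroupOf A' :=
  QuotientAddGroup.map _ _ ((f.comp A.subtype).codRestrict A' fun x => hA x.2) fun _ hx => hB hx

/-- The subquotient complex `A/(A ∩ B)` of a chain complex, for two families `A`, `B` of subgroups
stable under the differential. -/
def subquotientComplex (K : ChainComplex AddCommGrpCat.{w} ℕ) (A B : ∀ n, AddSubgroup (K.X n))
    (hA : ∀ m n, A m ≤ (A n).comap (K.d m n).hom)
    (hB : ∀ m n, B m ≤ (B n).comap (K.d m n).hom) : ChainComplex AddCommGrpCat.{w} ℕ where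
  X n := AddCommGrpCat.of (A n ⧸ (B n).addSubgroupOf (A n))
  d m n := AddCommGrpCat.ofHom (subquotientMap (K.d m n).hom (hA m n) (hB m n))
  shape m n h := by
    ext : 1
    refine QuotientAddGroup.addMonoidHom_ext _ (AddMonoidHom.ext fun x => ?_)
    refine (QuotientAddGroup.eq_zero_iff _).2 ?_
    change (K.d m n).hom x.1 ∈ B n
    rw [K.shape m n h]
    exact (B n).zero_mem
  d_comp_d' l m n _ _ := by
    ext : 1
    refine QuotientAddGroup.addMonoidHom_ext _ (AddMonoidHom.ext fun x => ?_)
    refine (QuotientAddGroup.eq_zero_iff _).2 ?_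
    have h0 : (K.d m n).hom ((K.d l m).hom x.1) = 0 := by
      rw [← AddMonoidHom.comp_apply, ← AddCommGrpCat.hom_comp, K.d_comp_d]
      rfl
    change (K.d m n).hom ((K.d l m).hom x.1) ∈ B n
    rw [h0]
    exact (B n).zero_mem

/-! ### The filtered complex of an `Fset`-category -/

namespace FsetCategory

variable {C : Type u} [FsetCategory.{u, v} C]

/-- The filtered nerve: the string `(f_1, …, f_n)` lies in the `ℓ`-th filtration step of
`⋃ C(a_0, a_1) × ⋯ × C(a_{n-1}, a_n)`, where `ℓ` is real (nothing lies in negative steps).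
If all morphisms have degrees, this says `deg f_1 + ⋯ + deg f_n ≤ ℓ`. -/
def InFil {n : ℕ} (s : ComposableArrows C n) (ℓ : ℝ) : Prop :=
  ∃ w : Fin n → ℝ≥0, (∀ i : Fin n, s.map (homOfLE i.castSucc_le_succ) ∈ fil _ _ (w i)) ∧
    ((∑ i, w i : ℝ≥0) : ℝ) ≤ ℓ

theorem map_mem_fil {n : ℕ} (s : ComposableArrows C n) (w : Fin n → ℝ≥0)
    (hw : ∀ i : Fin n, s.map (homOfLE i.castSucc_le_succ) ∈ fil _ _ (w i)) (a : Fin (n + 1)) :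
    ∀ (b : Fin (n + 1)) (h : a ≤ b), s.map (homOfLE h) ∈ fil _ _
      ((∑ i with i.castSucc < b, w i) - (∑ i with i.castSucc < a, w i)) := by
  intro b
  induction b using Fin.induction with
  | zero =>
    intro h
    obtain rfl : a = 0 := Fin.le_zero_iff.1 h
    have h1 : homOfLE h = 𝟙 _ := rfl
    rw [h1, s.map_id]
    exact fil_mono _ _ (zero_le) (id_mem _)
  | succ b ih =>
    intro h
    rcases h.eq_or_lt with rfl | h'
    · have h1 : homOfLE h = 𝟙 _ := rfl
      rw [h1, s.map_id]
      exact fil_mono _ _ (zero_le) (id_mem _)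
    · have hab : a ≤ b.castSucc := Fin.le_castSucc_iff.2 h'
      have h1 : homOfLE h = homOfLE hab ≫ homOfLE b.castSucc_le_succ := rfl
      rw [h1, s.map_comp]
      refine fil_mono _ _ ?_ (comp_mem (ih hab) (hw b))
      have h2 : (Finset.univ.filter fun i : Fin n => i.castSucc < b.succ) =
          insert b (Finset.univ.filter fun i : Fin n => i.castSucc < b.castSucc) := by
        ext i
        simp only [Finset.mem_filter, Finset.mem_univ, true_and, Finset.mem_insert, Fin.lt_def,
          Fin.ext_iff, Fin.val_castSucc, Fin.val_succ]
        omega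
      have h3 : ∑ i with i.castSucc < a, w i ≤ ∑ i with i.castSucc < b.castSucc, w i :=
        Finset.sum_le_sum_of_subset fun i hi => by
          simp only [Finset.mem_filter, Finset.mem_univ, true_and] at hi ⊢
          exact hi.trans_le hab
      rw [h2, Finset.sum_insert (by simp), add_comm (w b), tsub_add_eq_add_tsub h3]

theorem InFil.face {n : ℕ} {s : ComposableArrows C (n + 1)} {ℓ : ℝ} (h : InFil s ℓ)
    (i : Fin (n + 2)) : InFil (C := C) (n := n) ((nerve C).δ i s) ℓ := by
  obtain ⟨w, hw, hle⟩ := h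
  let θ : Fin (n + 1) →o Fin (n + 2) := (SimplexCategory.δ i).toOrderHom
  let W : Fin (n + 2) → ℝ≥0 := fun a => ∑ i with i.castSucc < a, w i
  have hW : Monotone W := fun a b hab => Finset.sum_le_sum_of_subset fun i hi => by
    simp only [Finset.mem_filter, Finset.mem_univ, true_and] at hi ⊢
    exact hi.trans_le hab
  refine ⟨fun j => W (θ j.succ) - W (θ j.castSucc), fun j => ?_, le_trans ?_ hle⟩
  · exact map_mem_fil s w hw _ _ (θ.monotone j.castSucc_le_succ)
  · let f : ℕ → ℝ≥0 := fun k => W (θ (Fin.ofNat (n + 1) (min k n)))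
    have hf : Monotone f := fun a b hab => hW (θ.monotone (by
      rw [Fin.le_def, Fin.val_ofNat, Fin.val_ofNat, Nat.mod_eq_of_lt (by omega),
        Nat.mod_eq_of_lt (by omega)]
      omega))
    have h1 : ∑ j : Fin n, (W (θ j.succ) - W (θ j.castSucc)) =
        ∑ j : Fin n, (f (j + 1) - f j) := by
      refine Finset.sum_congr rfl fun j _ => ?_
      have hj := j.isLt
      have e1 : Fin.ofNat (n + 1) (min ((j : ℕ) + 1) n) = j.succ := by
        rw [Fin.ext_iff, Fin.val_ofNat, Nat.mod_eq_of_lt (by omega), Fin.val_succ]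
        omega
      have e2 : Fin.ofNat (n + 1) (min (j : ℕ) n) = j.castSucc := by
        rw [Fin.ext_iff, Fin.val_ofNat, Nat.mod_eq_of_lt (by omega), Fin.val_castSucc]
        omega
      simp only [f, e1, e2]
    rw [h1, Fin.sum_univ_eq_sum_range (fun k => f (k + 1) - f k) n, Finset.sum_range_tsub hf]
    refine NNReal.coe_le_coe.2 (tsub_le_self.trans ?_)
    exact Finset.sum_le_sum_of_subset (Finset.filter_subset _ _)

variable (C)

/-- The complex `FC_• C` with the filtration forgotten: the integral chains on the nerve of the
underlying small category. Its homology is the homology of the underlying small category. -/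
def FC : ChainComplex AddCommGrpCat.{max u v} ℕ :=
  simplicialChains.obj (nerve C)

/-- `(FC_n C)_ℓ`. -/
def FCle (ℓ : ℝ) (n : ℕ) : AddSubgroup ((FC C).X n) :=
  chainSpan (X := nerve C) {s | InFil (C := C) (n := n) s ℓ}

/-- `(FC_n C)_{<ℓ}`. -/
def FClt (ℓ : ℝ) (n : ℕ) : AddSubgroup ((FC C).X n) :=
  chainSpan (X := nerve C) {s | ∃ ℓ' < ℓ, InFil (C := C) (n := n) s ℓ'}

/-- The chains generated by the strings `(f_1, …, f_n)` with some `f_i` an identity. -/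
def FCdeg (n : ℕ) : AddSubgroup ((FC C).X n) :=
  degenerateChains (nerve C) n

theorem FCle_d (ℓ : ℝ) (m n : ℕ) : FCle C ℓ m ≤ (FCle C ℓ n).comap ((FC C).d m n).hom :=
  chainSpan_d_le_of_face (X := nerve C) (fun n => {s | InFil (C := C) (n := n) s ℓ})
    (fun _ _ hs i => InFil.face hs i) m n

theorem FClt_d (ℓ : ℝ) (m n : ℕ) : FClt C ℓ m ≤ (FClt C ℓ n).comap ((FC C).d m n).hom :=
  chainSpan_d_le_of_face (X := nerve C) (fun n => {s | ∃ ℓ' < ℓ, InFil (C := C) (n := n) s ℓ'})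
    (fun _ _ ⟨ℓ', hℓ, hs⟩ i => ⟨ℓ', hℓ, InFil.face hs i⟩) m n

theorem FClt_sup_FCdeg_d (ℓ : ℝ) (m n : ℕ) :
    FClt C ℓ m ⊔ FCdeg C m ≤ (FClt C ℓ n ⊔ FCdeg C n).comap ((FC C).d m n).hom :=
  sup_le ((FClt_d C ℓ m n).trans (AddSubgroup.comap_mono le_sup_left))
    ((degenerateChains_d (nerve C) m n).trans (AddSubgroup.comap_mono le_sup_right))

/-- The un-normalized magnitude chain complex `(FC_• C)_ℓ / (FC_• C)_{<ℓ}`. -/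
def unnormalizedMC (ℓ : ℝ) : ChainComplex AddCommGrpCat.{max u v} ℕ :=
  subquotientComplex (FC C) (FCle C ℓ) (FClt C ℓ) (FCle_d C ℓ) (FClt_d C ℓ)

/-- The class of a chain of `(FC_n C)_ℓ` in the un-normalized magnitude chain complex. -/
def unnormalizedMCMk {ℓ : ℝ} {n : ℕ} (x : FCle C ℓ n) : (unnormalizedMC C ℓ).X n :=
  QuotientAddGroup.mk x

/-- The magnitude chain complex: the quotient of the un-normalized magnitude chain complex by the
degenerate strings, that is, `(FC_• C)_ℓ` modulo `(FC_• C)_{<ℓ}` and the degenerate strings. -/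
def MC (ℓ : ℝ) : ChainComplex AddCommGrpCat.{max u v} ℕ :=
  subquotientComplex (FC C) (FCle C ℓ) (fun n => FClt C ℓ n ⊔ FCdeg C n) (FCle_d C ℓ)
    (FClt_sup_FCdeg_d C ℓ)

/-- The class of a chain of `(FC_n C)_ℓ` in the magnitude chain complex. -/
def MCMk {ℓ : ℝ} {n : ℕ} (x : FCle C ℓ n) : (MC C ℓ).X n :=
  QuotientAddGroup.mk x

/-- The magnitude homology `MH^ℓ_n C`. -/
abbrev MH (ℓ : ℝ) (n : ℕ) : AddCommGrpCat.{max u v} := (MC C ℓ).homology n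

end FsetCategory

/-! ### The spectral sequence of a filtered complex

`K` is a chain complex and `F p n` is the `p`-th filtration step of its `n`-chains. Terms are indexed
by the filtration degree `p` and the total degree `n = p + q`, so that `page K F r p n` is
`E^r_{p, n - p}`. -/

section SpectralSequence

variable (K : ChainComplex AddCommGrpCat.{w} ℕ) (F : ℤ → ∀ n, AddSubgroup (K.X n))

/-- `Z^r_p = {x ∈ F_p K_n | ∂x ∈ F_{p-r} K_{n-1}}`. -/
def pageZ (r p : ℤ) (n : ℕ) : AddSubgroup (K.X n) :=
  F p n ⊓ ⨅ m, (F (p - r) m).comap (K.d n m).hom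

/-- `Z^{r-1}_{p-1} + ∂ Z^{r-1}_{p+r-1}`. -/
def pageB (r p : ℤ) (n : ℕ) : AddSubgroup (K.X n) :=
  pageZ K F (r - 1) (p - 1) n ⊔ (pageZ K F (r - 1) (p + r - 1) (n + 1)).map (K.d (n + 1) n).hom

/-- `E^r_{p,q} = Z^r_p / (Z^{r-1}_{p-1} + ∂ Z^{r-1}_{p+r-1})` in total degree `n = p + q`. -/
abbrev page (r p : ℤ) (n : ℕ) : Type w :=
  pageZ K F r p n ⧸ (pageB K F r p n).addSubgroupOf (pageZ K F r p n)

/-- The class in `E^r_{p,q}` of a chain in `Z^r_p`. -/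
def pageMk {r p : ℤ} {n : ℕ} (x : pageZ K F r p n) : page K F r p n :=
  QuotientAddGroup.mk x

theorem pageZ_d {r p p' : ℤ} (h : p' + r = p) (n m : ℕ) :
    pageZ K F r p n ≤ (pageZ K F r p' m).comap (K.d n m).hom := by
  intro x hx
  obtain rfl : p' = p - r := by omega
  refine ⟨(AddSubgroup.mem_iInf.1 hx.2 m), AddSubgroup.mem_iInf.2 fun k => ?_⟩
  have h0 : (K.d m k).hom ((K.d n m).hom x) = 0 := by
    rw [← AddMonoidHom.comp_apply, ← AddCommGrpCat.hom_comp, K.d_comp_d]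
    rfl
  rw [AddSubgroup.mem_comap, h0]
  exact AddSubgroup.zero_mem _

theorem pageB_d {r p p' : ℤ} (h : p' + r = p) (n m : ℕ) :
    pageB K F r p n ≤ (pageB K F r p' m).comap (K.d n m).hom := by
  refine sup_le (fun x hx => ?_) ?_
  · by_cases hnm : m + 1 = n
    · subst hnm
      refine AddSubgroup.mem_sup_right (AddSubgroup.mem_map_of_mem _ ?_)
      rwa [show p' + r - 1 = p - 1 by omega]
    · rw [AddSubgroup.mem_comap, K.shape n m hnm]
      exact AddSubgroup.zero_mem _
  · rintro _ ⟨y, -, rfl⟩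
    have h0 : (K.d n m).hom ((K.d (n + 1) n).hom y) = 0 := by
      rw [← AddMonoidHom.comp_apply, ← AddCommGrpCat.hom_comp, K.d_comp_d]
      rfl
    rw [AddSubgroup.mem_comap, h0]
    exact AddSubgroup.zero_mem _

/-- The differential `d^r : E^r_p → E^r_{p'}`, `p' = p - r`, from total degree `n` to total
degree `m`, induced by `∂`. It is zero unless `m = n - 1`. -/
def pageD (r : ℤ) {p p' : ℤ} (h : p' + r = p) (n m : ℕ) : page K F r p n →+ page K F r p' m :=
  subquotientMap (K.d n m).hom (pageZ_d K F h n m) (pageB_d K F h n m)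

/-- The differential `d^r` out of `E^r_{p,q}`, with `n = p + q` (the zero map if `n = 0`). -/
def dOut (r p : ℤ) (n : ℕ) : page K F r p n →+ page K F r (p - r) (n - 1) :=
  pageD K F r (sub_add_cancel p r) n (n - 1)

/-- The differential `d^r` into `E^r_{p,q}`, with `n = p + q`. -/
def dIn (r p : ℤ) (n : ℕ) : page K F r (p + r) (n + 1) →+ page K F r p n :=
  pageD K F r rfl (n + 1) n

/-- The cycles `Z^∞ = ⋂_r Z^r` for the limit term. -/
def pageZInf (p : ℤ) (n : ℕ) : AddSubgroup (K.X n) := ⨅ r : ℕ, pageZ K F r p n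

/-- The boundaries for the limit term, the union over all pages. -/
def pageBInf (p : ℤ) (n : ℕ) : AddSubgroup (K.X n) := ⨆ r : ℕ, pageB K F r p n

/-- The limit term `E^∞_{p,q}`, with `n = p + q`. -/
abbrev pageInf (p : ℤ) (n : ℕ) : Type w :=
  pageZInf K F p n ⧸ (pageBInf K F p n).addSubgroupOf (pageZInf K F p n)

/-- The filtration `F_p H_n(K)` of the homology: the classes of the cycles in `F_p K_n`. -/
def homologyFil (p : ℤ) (n : ℕ) : AddSubgroup (K.homology n) :=
  ((F p n).comap (K.iCycles n).hom).map (K.homologyπ n).hom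

/-- `F_p H_n(K) / F_{p-1} H_n(K)`. -/
abbrev homologyGr (p : ℤ) (n : ℕ) : Type w :=
  homologyFil K F p n ⧸ (homologyFil K F (p - 1) n).addSubgroupOf (homologyFil K F p n)

/-- `E^{r+1}` is the homology of `E^r` with respect to `d^r`, by the map that sends the class of a
chain `x` to the class of the class of `x`. -/
def NextPageIsHomology (r : ℕ) (p : ℤ) (n : ℕ) : Prop :=
  (dIn K F r p n).range ≤ (dOut K F r p n).ker ∧
  ∃ φ : page K F ((r : ℤ) + 1) p n ≃+
      (dOut K F r p n).ker ⧸ (dIn K F r p n).range.addSubgroupOf (dOut K F r p n).ker,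
    ∀ (x : K.X n) (h₁ : x ∈ pageZ K F ((r : ℤ) + 1) p n) (h₂ : x ∈ pageZ K F r p n)
      (h₃ : pageMk K F ⟨x, h₂⟩ ∈ (dOut K F r p n).ker),
      φ (pageMk K F ⟨x, h₁⟩) = QuotientAddGroup.mk ⟨pageMk K F ⟨x, h₂⟩, h₃⟩

/-- From the page `r₀` on, all differentials into and out of the term at `(p, n)` vanish. -/
def StableFrom (r₀ : ℕ) (p : ℤ) (n : ℕ) : Prop :=
  ∀ r : ℕ, r₀ ≤ r → dOut K F r p n = 0 ∧ dIn K F r p n = 0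

/-- `E^r_{p,q} ≅ F_p H_n(K) / F_{p-1} H_n(K)`, `n = p + q`, by an isomorphism that sends the class
of a cycle to its homology class. -/
def PageIsGr (r : ℕ) (p : ℤ) (n : ℕ) : Prop :=
  ∃ φ : page K F r p n ≃+ homologyGr K F p n,
    ∀ (z : K.cycles n) (h₁ : (K.iCycles n).hom z ∈ pageZ K F r p n)
      (h₂ : (K.homologyπ n).hom z ∈ homologyFil K F p n),
      φ (pageMk K F ⟨(K.iCycles n).hom z, h₁⟩) = QuotientAddGroup.mk ⟨(K.homologyπ n).hom z, h₂⟩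

/-- `E^∞_{p,q} ≅ F_p H_n(K) / F_{p-1} H_n(K)`, `n = p + q`, by an isomorphism that sends the class
of a cycle to its homology class. -/
def PageInfIsGr (p : ℤ) (n : ℕ) : Prop :=
  ∃ φ : pageInf K F p n ≃+ homologyGr K F p n,
    ∀ (z : K.cycles n) (h₁ : (K.iCycles n).hom z ∈ pageZInf K F p n)
      (h₂ : (K.homologyπ n).hom z ∈ homologyFil K F p n),
      φ (QuotientAddGroup.mk ⟨(K.iCycles n).hom z, h₁⟩) =
        QuotientAddGroup.mk ⟨(K.homologyπ n).hom z, h₂⟩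

end SpectralSequence

namespace FsetCategory

variable (C : Type u) [FsetCategory.{u, v} C]

/-- The filtration of `FC_• C` restricted to integers. -/
abbrev FCfil (p : ℤ) (n : ℕ) : AddSubgroup ((FC C).X n) := FCle C (p : ℝ) n

/-- The term `E^r_{p,q}` in total degree `n = p + q` of the spectral sequence of `FC_• C`. -/
abbrev E (r p : ℤ) (n : ℕ) : Type (max u v) := page (FC C) (FCfil C) r p n

/-- The homology of the small category underlying `C`, that is, of its nerve. -/
abbrev underlyingHomology (n : ℕ) : AddCommGrpCat.{max u v} := (FC C).homology n

end FsetCategory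

/-! ### Digraphs -/

namespace Digraph

variable {V : Type u} (G : Digraph V)

/-- There are `a = x_0, …, x_n = b` with `(x_i, x_{i+1})` an edge for all `i < n`
(the values of `x` beyond `n` are irrelevant). -/
def HasWalk (n : ℕ) (a b : V) : Prop :=
  ∃ x : ℕ → V, x 0 = a ∧ x n = b ∧ ∀ i < n, G.Adj (x i) (x (i + 1))

/-- The directed path metric. -/
def pathDist (a b : V) : ℕ∞ := ⨅ (n : ℕ) (_ : G.HasWalk n a b), (n : ℕ∞)

theorem pathDist_self (a : V) : G.pathDist a a = 0 :=
  le_antisymm (iInf₂_le_of_le 0 ⟨fun _ => a, rfl, rfl, fun i hi => absurd hi (by omega)⟩ (by simp))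
    bot_le

theorem HasWalk.trans {m n : ℕ} {a b c : V} (h₁ : G.HasWalk m a b) (h₂ : G.HasWalk n b c) :
    G.HasWalk (m + n) a c := by
  obtain ⟨x, hx0, hxm, hx⟩ := h₁
  obtain ⟨y, hy0, hyn, hy⟩ := h₂
  refine ⟨fun i => if i < m then x i else y (i - m), ?_, ?_, fun i hi => ?_⟩
  · dsimp only
    split_ifs with h
    · exact hx0
    · obtain rfl : m = 0 := by omega
      rw [Nat.sub_zero, hy0, ← hxm, hx0]
  · simp [hyn]
  · dsimp only
    rcases lt_trichotomy (i + 1) m with h | h | h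
    · rw [if_pos (by omega), if_pos h]
      exact hx i (by omega)
    · rw [if_pos (by omega), if_neg (by omega), h, Nat.sub_self, hy0, ← hxm, ← h]
      exact hx i (by omega)
    · rw [if_neg (by omega), if_neg (by omega), show i + 1 - m = i - m + 1 by omega]
      exact hy _ (by omega)

theorem pathDist_triangle (a b c : V) :
    G.pathDist a c ≤ G.pathDist a b + G.pathDist b c := by
  unfold pathDist
  simp only [ENat.iInf_add, ENat.add_iInf, le_iInf_iff]
  intro m hm n hn
  exact iInf₂_le_of_le (n + m) (hn.trans G hm) (by simp)

/-- The vertices of `G`, as the objects of the `Fset`-category of `G`. -/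
structure Cat (G : Digraph V) : Type u where
  vertex : V

/-- The `Fset`-category of a digraph: there is a morphism `a ⟶ b` if and only if `d(a, b) < ∞`,
it is then unique, and its degree is `d(a, b)`, for the directed path metric `d`. -/
instance : FsetCategory.{u, 0} G.Cat where
  Hom a b := PLift (G.pathDist a.vertex b.vertex ≠ ⊤)
  id a := ⟨by simp [pathDist_self]⟩
  comp {a b c} f g :=
    ⟨ne_top_of_le_ne_top (by simp [f.down, g.down]) (pathDist_triangle G _ b.vertex _)⟩
  fil a b ℓ := {_f | ((G.pathDist a.vertex b.vertex : ℕ∞) : ℝ≥0∞) ≤ (ℓ : ℝ≥0∞)}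
  fil_mono a b ℓ ℓ' h f hf := le_trans (b := (ℓ : ℝ≥0∞)) hf (ENNReal.coe_le_coe.2 h)
  fil_exhaustive {a b} f := by
    obtain ⟨k, hk⟩ := ENat.ne_top_iff_exists.1 f.down
    exact ⟨k, by simp [← hk]⟩
  id_mem a := by simp [pathDist_self]
  comp_mem {a b c f g ℓ ℓ'} hf hg := by
    have h : ((G.pathDist a.vertex c.vertex : ℕ∞) : ℝ≥0∞) ≤
        (G.pathDist a.vertex b.vertex : ℕ∞) + (G.pathDist b.vertex c.vertex : ℕ∞) := by
      exact_mod_cast pathDist_triangle G _ _ _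
    refine h.trans ((add_le_add hf hg).trans ?_)
    rw [ENNReal.coe_add]

theorem isIntegral_cat : FsetCategory.IsIntegral G.Cat := by
  intro a b f
  obtain ⟨k, hk⟩ := ENat.ne_top_iff_exists.1 f.down
  refine ⟨k, ?_, fun ℓ' h => ?_⟩
  · change ((G.pathDist a.vertex b.vertex : ℕ∞) : ℝ≥0∞) ≤ (((k : ℝ≥0)) : ℝ≥0∞)
    simp [← hk]
  · change ¬ ((G.pathDist a.vertex b.vertex : ℕ∞) : ℝ≥0∞) ≤ (ℓ' : ℝ≥0∞)
    rw [← hk, not_le]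
    have h1 : (((k : ℕ∞)) : ℝ≥0∞) = (((k : ℝ≥0)) : ℝ≥0∞) := by simp
    rw [h1]
    exact ENNReal.coe_lt_coe.2 h

/-! ### Path homology -/

/-- The simplicial set whose `n`-simplices are all sequences `(x_0, …, x_n)` in `V`. Its `n`-chains
are the group `Λ_n` of elementary `n`-paths. -/
def tuples (V : Type u) : SSet.{u} where
  obj Δ := Fin (Δ.unop.len + 1) → V
  map f := ↾fun x => x ∘ f.unop.toOrderHom
  map_id _ := rfl
  map_comp _ _ := rfl

/-- The `i`-th entry `x_i` of `(x_0, …, x_n)`. -/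
def tupleEntry {V : Type u} {n : ℕ} (x : (tuples V) _⦋n⦌) (i : Fin (n + 1)) : V :=
  (show Fin (n + 1) → V from x) i

/-- The elementary paths `(x_0, …, x_n)` with `x_i = x_{i+1}` for some `i`. -/
def irregularTuples (V : Type u) (n : ℕ) : Set ((tuples V) _⦋n⦌) :=
  {x | ∃ i : Fin n, tupleEntry x i.castSucc = tupleEntry x i.succ}

/-- The allowed elementary paths: `(x_i, x_{i+1})` is an edge for all `i`. -/
def allowedTuples (n : ℕ) : Set ((tuples V) _⦋n⦌) :=
  {x | ∀ i : Fin n, G.Adj (tupleEntry x i.castSucc) (tupleEntry x i.succ)}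

/-- The group `I_n` of irregular paths. The regular paths are `R_n = Λ_n / I_n`. -/
def irregularPaths (V : Type u) (n : ℕ) : AddSubgroup ((simplicialChains.obj (tuples V)).X n) :=
  chainSpan (irregularTuples V n)

/-- The preimage in `Λ_n` of the group `A_n ⊆ R_n` of allowed paths. -/
def allowedPaths (n : ℕ) : AddSubgroup ((simplicialChains.obj (tuples V)).X n) :=
  chainSpan (G.allowedTuples n) ⊔ irregularPaths V n

/-- The preimage in `Λ_n` of the group `Ω_n = {v ∈ A_n | ∂v ∈ A_{n-1}} ⊆ R_n` of `∂`-invariant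
allowed paths. -/
def invariantPaths (n : ℕ) : AddSubgroup ((simplicialChains.obj (tuples V)).X n) :=
  G.allowedPaths n ⊓ ⨅ m, (G.allowedPaths m).comap ((simplicialChains.obj (tuples V)).d n m).hom

theorem irregularTuples_eq_degenerate (V : Type u) (n : ℕ) :
    irregularTuples V n = (tuples V).degenerate n := by
  obtain _ | n := n
  · ext x
    simp [irregularTuples]
  rw [SSet.degenerate_eq_iUnion_range_σ]
  ext x
  rw [Set.mem_iUnion]
  refine exists_congr fun i => ⟨fun h => ?_, ?_⟩
  · refine ⟨(tuples V).δ i.castSucc x, funext fun j => ?_⟩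
    change (x : Fin (n + 2) → V) (i.castSucc.succAbove (i.predAbove j)) = x j
    change (x : Fin (n + 2) → V) i.castSucc = (x : Fin (n + 2) → V) i.succ at h
    by_cases hj : j = i.castSucc
    · subst hj
      simp [← h]
    · congr 1
      rw [Fin.succAbove_predAbove hj]
  · rintro ⟨y, rfl⟩
    change (y : Fin (n + 1) → V) (i.predAbove i.castSucc) =
      (y : Fin (n + 1) → V) (i.predAbove i.succ)
    simp

theorem irregularPaths_d (V : Type u) (m n : ℕ) : irregularPaths V m ≤
    (irregularPaths V n).comap ((simplicialChains.obj (tuples V)).d m n).hom := by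
  unfold irregularPaths
  rw [irregularTuples_eq_degenerate, irregularTuples_eq_degenerate]
  exact degenerateChains_d (tuples V) m n

theorem invariantPaths_d (m n : ℕ) : G.invariantPaths m ≤
    (G.invariantPaths n).comap ((simplicialChains.obj (tuples V)).d m n).hom := by
  intro x hx
  refine ⟨AddSubgroup.mem_iInf.1 hx.2 n, AddSubgroup.mem_iInf.2 fun k => ?_⟩
  have h0 : ((simplicialChains.obj (tuples V)).d n k).hom
      (((simplicialChains.obj (tuples V)).d m n).hom x) = 0 := by
    rw [← AddMonoidHom.comp_apply, ← AddCommGrpCat.hom_comp, HomologicalComplex.d_comp_d]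
    rfl
  rw [AddSubgroup.mem_comap, h0]
  exact AddSubgroup.zero_mem _

/-- The complex `Ω_•` of `∂`-invariant allowed paths, as a subcomplex of the regular paths `R_•`. -/
def pathComplex : ChainComplex AddCommGrpCat.{u} ℕ :=
  subquotientComplex (simplicialChains.obj (tuples V)) G.invariantPaths (irregularPaths V)
    G.invariantPaths_d (irregularPaths_d V)

/-- The class in `Ω_n ⊆ R_n` of a representative in `Λ_n`. -/
def pathMk {n : ℕ} (x : G.invariantPaths n) : G.pathComplex.X n :=
  QuotientAddGroup.mk x

/-- The (regular, integral) path homology `H_n(G)`. -/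
abbrev pathHomology (n : ℕ) : AddCommGrpCat.{u} := G.pathComplex.homology n

/-- The sum of coefficients on `Λ_0`. -/
def coeffSum (V : Type u) : (simplicialChains.obj (tuples V)).X 0 →+ ULift.{u} ℤ :=
  (Finsupp.liftAddHom fun _ => (AddEquiv.ulift (α := ℤ)).symm.toAddMonoidHom :
    ((tuples V) _⦋0⦌ →₀ ℤ) →+ ULift.{u} ℤ)

theorem coeffSum_simplexChain (x : (tuples V) _⦋0⦌) : coeffSum V (simplexChain x) = ⟨1⟩ :=
  Finsupp.liftAddHom_apply_single _ x 1

theorem irregularPaths_zero_le (V : Type u) :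
    irregularPaths V 0 ≤ (coeffSum V).ker := by
  refine (AddSubgroup.closure_le _).2 ?_
  rintro _ ⟨x, ⟨i, -⟩, rfl⟩
  exact i.elim0

theorem coeffSum_d (x : (simplicialChains.obj (tuples V)).X 1) :
    coeffSum V (((simplicialChains.obj (tuples V)).d 1 0).hom x) = 0 := by
  have h : ((coeffSum V).comp ((simplicialChains.obj (tuples V)).d 1 0).hom :
      ((tuples V) _⦋1⦌ →₀ ℤ) →+ ULift.{u} ℤ) = 0 := by
    refine Finsupp.addHom_ext' fun s => AddMonoidHom.ext_int ?_
    change coeffSum V (((simplicialChains.obj (tuples V)).d 1 0).hom (simplexChain s)) = 0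
    rw [simplicialChains_d, map_sum]
    simp only [map_zsmul, coeffSum_simplexChain]
    rfl
  exact DFunLike.congr_fun h x

/-- The augmentation `Ω_0 → ℤ`, sending each vertex to `1`. -/
def pathAugmentation : G.pathComplex.X 0 ⟶ AddCommGrpCat.of (ULift.{u} ℤ) :=
  AddCommGrpCat.ofHom (QuotientAddGroup.lift _ ((coeffSum V).comp (G.invariantPaths 0).subtype)
    fun _ hx => irregularPaths_zero_le V hx)

theorem d_pathAugmentation : G.pathComplex.d 1 0 ≫ G.pathAugmentation = 0 := by
  ext : 1
  exact QuotientAddGroup.addMonoidHom_ext _ (AddMonoidHom.ext fun x => coeffSum_d x.1)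

/-- The reduced path homology `H̃_n(G)`: the homology at `Ω_n` of the augmented complex
`0 ← ℤ ← Ω_0 ← Ω_1 ← ⋯`. -/
abbrev reducedPathHomology (n : ℕ) : AddCommGrpCat.{u} :=
  (G.pathComplex.augment G.pathAugmentation G.d_pathAugmentation).homology (n + 1)

/-- The map from the nerve of the category of `G` that sends a string of morphisms to the sequence
of its vertices. -/
def vertexMap : nerve G.Cat ⟶ tuples V where
  app _ := ↾fun s i => (s.obj i).vertex
  naturality _ _ _ := rfl

/-- The map `FC_n → Λ_n` induced by `vertexMap`. -/
def vertexChainMap (n : ℕ) :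
    (FsetCategory.FC G.Cat).X n →+ (simplicialChains.obj (tuples V)).X n :=
  ((simplicialChains.map G.vertexMap).f n).hom

end Digraph

end

/-! Three ingredients prove the theorem: the formalism of filtered complexes, a normalization that
respects the filtration, and a count of degrees in digraphs. All isomorphisms are produced alike:
two surjections out of one group of chains with the same kernel have isomorphic targets
(`exists_addEquiv_of_ker_eq`), so the maps are determined on representatives.

The filtration of `FC_• C` vanishes in negative degrees and is exhaustive
(`isConvergentFiltration`). Hence a chain in `Z^r_p` with `r > p` is a cycle, and every bounding
chain lies in some `F_s`; this yields `pageInfIsGr`. No `s` works for all bounding chains, so a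
fixed page computes the associated graded only when the later differentials vanish
(`pageIsGr_of_stableFrom`), for instance when the degrees are bounded.

Integrality turns "degree less than `p`" into "degree at most `p - 1`", which gives `E^0`. For `E^1`
the degenerate strings must be discarded. The Dold–Kan projector kills them and is homotopic to the
identity. Both the projector and the homotopy are built from faces and degeneracies, which do not
raise the total degree of a string, so both preserve every `F_ℓ`. A chain thus agrees with its
normalization up to the denominator of the page (`exists_eq_normalize_add`), and the normalization
depends only on the chain modulo degenerate ones.

In the category of a digraph every non-identity morphism has degree at least `1`, with equality
exactly for edges. So in chain degree `n`, modulo degenerate strings, `F_{n-1}` is zero and `F_n` is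
the group of allowed paths. Therefore `Z^2_p` in degree `p` gives the cycles of `Ω_p`, and
`Z^1_{p+1}` in degree `p + 1`, whose boundaries are divided out, gives `Ω_{p+1}`. Normalized lifts
show that nothing is lost (`exists_mem_pageZ_two`, `mem_pageB_two_iff`). -/

noncomputable section

/-! ### Isomorphisms determined on representatives -/

/-- Two surjections with the same kernel have isomorphic targets. -/
theorem exists_addEquiv_of_ker_eq {A M N : Type*} [AddGroup A] [AddGroup M]
    [AddGroup N] (f : A →+ M) (g : A →+ N) (hf : Function.Surjective f)
    (hg : Function.Surjective g) (h : ∀ a, f a = 0 ↔ g a = 0) :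
    ∃ φ : M ≃+ N, ∀ a, φ (f a) = g a := by
  have hk : f.ker = g.ker := AddSubgroup.ext h
  refine ⟨((QuotientAddGroup.quotientKerEquivOfSurjective f hf).symm.trans
    (QuotientAddGroup.quotientAddEquivOfEq hk)).trans
    (QuotientAddGroup.quotientKerEquivOfSurjective g hg), fun a => ?_⟩
  have h1 : (QuotientAddGroup.quotientKerEquivOfSurjective f hf).symm (f a) =
      QuotientAddGroup.mk a := (AddEquiv.symm_apply_eq _).2 rfl
  simp only [AddEquiv.trans_apply, h1]
  rfl

theorem mk_eq_zero_iff_mem {M : Type*} [AddCommGroup M] {A B : AddSubgroup M} (x : A) :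
    (QuotientAddGroup.mk x : A ⧸ B.addSubgroupOf A) = 0 ↔ x.1 ∈ B :=
  (QuotientAddGroup.eq_zero_iff x).trans AddSubgroup.mem_addSubgroupOf

/-! ### Homology of complexes of abelian groups, by elements -/

namespace ChainComplex

variable (K : ChainComplex AddCommGrpCat.{w} ℕ)

theorem d_d_apply (l m n : ℕ) (x : K.X l) : (K.d m n).hom ((K.d l m).hom x) = 0 := by
  rw [← AddMonoidHom.comp_apply, ← AddCommGrpCat.hom_comp, K.d_comp_d]
  rfl

theorem d_apply_eq_zero_of_ne {m n : ℕ} (h : n + 1 ≠ m) (x : K.X m) : (K.d m n).hom x = 0 := by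
  rw [K.shape m n h]
  rfl

theorem iCycles_injective (n : ℕ) : Function.Injective (K.iCycles n).hom :=
  (AddCommGrpCat.mono_iff_injective _).1 inferInstance

theorem homologyπ_surjective (n : ℕ) : Function.Surjective (K.homologyπ n).hom :=
  (AddCommGrpCat.epi_iff_surjective _).1 inferInstance

theorem d_iCycles_apply (n m : ℕ) (z : K.cycles n) : (K.d n m).hom ((K.iCycles n).hom z) = 0 := by
  rw [← AddMonoidHom.comp_apply, ← AddCommGrpCat.hom_comp, K.iCycles_d]
  rfl

theorem exists_iCycles_eq {n : ℕ} (x : K.X n) (h : ∀ m, (K.d n m).hom x = 0) :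
    ∃ z : K.cycles n, (K.iCycles n).hom z = x :=
  ⟨(K.sc n).abCyclesIso.inv ⟨x, h _⟩, (K.sc n).abCyclesIso_inv_apply_iCycles ⟨x, h _⟩⟩

theorem homologyπ_eq_zero_iff {n : ℕ} (z : K.cycles n) :
    (K.homologyπ n).hom z = 0 ↔ ∃ y : K.X (n + 1), (K.d (n + 1) n).hom y = (K.iCycles n).hom z := by
  have hex : (ShortComplex.mk (K.toCycles (n + 1) n) (K.homologyπ n)
      (K.toCycles_comp_homologyπ (n + 1) n)).Exact :=
    ShortComplex.exact_of_g_is_cokernel _ (K.homologyIsCokernel (n + 1) n (by simp))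
  rw [ShortComplex.ab_exact_iff] at hex
  have hi : ∀ y, (K.iCycles n).hom ((K.toCycles (n + 1) n).hom y) = (K.d (n + 1) n).hom y := by
    intro y
    rw [← AddMonoidHom.comp_apply, ← AddCommGrpCat.hom_comp, K.toCycles_i]
  constructor
  · intro h
    obtain ⟨y, hy⟩ := hex z h
    exact ⟨y, by rw [← hi]; exact congrArg _ hy⟩
  · rintro ⟨y, hy⟩
    obtain rfl : (K.toCycles (n + 1) n).hom y = z := K.iCycles_injective n (by rw [hi, hy])
    rw [← AddMonoidHom.comp_apply, ← AddCommGrpCat.hom_comp, K.toCycles_comp_homologyπ]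
    rfl

/-- The subgroup of `K.X n` of all cycles. -/
def cycleSubgroup (n : ℕ) : AddSubgroup (K.X n) := ⨅ m, (K.d n m).hom.ker

variable {K} in
theorem mem_cycleSubgroup {n : ℕ} {x : K.X n} :
    x ∈ K.cycleSubgroup n ↔ ∀ m, (K.d n m).hom x = 0 := by
  simp [cycleSubgroup, AddSubgroup.mem_iInf, AddMonoidHom.mem_ker]

/-- The homology class of an element that is a cycle. -/
def homologyClass (n : ℕ) : K.cycleSubgroup n →+ K.homology n :=
  (K.homologyπ n).hom.comp
    { toFun := fun x => (K.exists_iCycles_eq x.1 (mem_cycleSubgroup.1 x.2)).choose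
      map_zero' := K.iCycles_injective n
        ((K.exists_iCycles_eq _ (mem_cycleSubgroup.1 (0 : K.cycleSubgroup n).2)).choose_spec.trans
          (map_zero _).symm)
      map_add' := fun x y => K.iCycles_injective n (by
        rw [map_add, (K.exists_iCycles_eq x.1 (mem_cycleSubgroup.1 x.2)).choose_spec,
          (K.exists_iCycles_eq y.1 (mem_cycleSubgroup.1 y.2)).choose_spec]
        exact (K.exists_iCycles_eq _ (mem_cycleSubgroup.1 (x + y).2)).choose_spec) }

theorem homologyClass_iCycles {n : ℕ} (z : K.cycles n)
    (h : (K.iCycles n).hom z ∈ K.cycleSubgroup n) :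
    K.homologyClass n ⟨(K.iCycles n).hom z, h⟩ = (K.homologyπ n).hom z := by
  refine congrArg (K.homologyπ n).hom (K.iCycles_injective n ?_)
  exact (K.exists_iCycles_eq _ (mem_cycleSubgroup.1 h)).choose_spec

theorem exists_homologyClass_eq {n : ℕ} (x : K.cycleSubgroup n) :
    ∃ z : K.cycles n, (K.iCycles n).hom z = x.1 ∧
      K.homologyClass n x = (K.homologyπ n).hom z :=
  ⟨_, (K.exists_iCycles_eq x.1 (mem_cycleSubgroup.1 x.2)).choose_spec, rfl⟩

theorem homologyClass_surjective (n : ℕ) : Function.Surjective (K.homologyClass n) := by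
  intro y
  obtain ⟨z, rfl⟩ := K.homologyπ_surjective n y
  exact ⟨⟨_, mem_cycleSubgroup.2 fun m => K.d_iCycles_apply n m z⟩, K.homologyClass_iCycles z _⟩

theorem homologyClass_eq_zero_iff {n : ℕ} (x : K.cycleSubgroup n) :
    K.homologyClass n x = 0 ↔ ∃ y : K.X (n + 1), (K.d (n + 1) n).hom y = x.1 := by
  obtain ⟨z, hz, h⟩ := K.exists_homologyClass_eq x
  rw [h, homologyπ_eq_zero_iff, hz]

end ChainComplex

/-! ### The spectral sequence of a filtered complex -/

section SpectralSequence

variable {K : ChainComplex AddCommGrpCat.{w} ℕ} {F : ℤ → ∀ n, AddSubgroup (K.X n)}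

theorem mem_pageZ {r p : ℤ} {n : ℕ} {x : K.X n} :
    x ∈ pageZ K F r p n ↔ x ∈ F p n ∧ ∀ m, (K.d n m).hom x ∈ F (p - r) m := by
  simp [pageZ, AddSubgroup.mem_inf, AddSubgroup.mem_iInf]

theorem mem_pageB {r p : ℤ} {n : ℕ} {x : K.X n} :
    x ∈ pageB K F r p n ↔ ∃ a ∈ pageZ K F (r - 1) (p - 1) n,
      ∃ b ∈ pageZ K F (r - 1) (p + r - 1) (n + 1), a + (K.d (n + 1) n).hom b = x := by
  simp [pageB, AddSubgroup.mem_sup]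

theorem pageMk_eq_zero_iff {r p : ℤ} {n : ℕ} (x : pageZ K F r p n) :
    pageMk K F x = 0 ↔ x.1 ∈ pageB K F r p n :=
  mk_eq_zero_iff_mem x

theorem pageMk_surjective {r p : ℤ} {n : ℕ} :
    Function.Surjective (pageMk K F : pageZ K F r p n → page K F r p n) :=
  QuotientAddGroup.mk_surjective

theorem pageD_pageMk {r p p' : ℤ} (h : p' + r = p) (n m : ℕ) (x : pageZ K F r p n) :
    pageD K F r h n m (pageMk K F x) =
      pageMk K F ⟨(K.d n m).hom x.1, pageZ_d K F h n m x.2⟩ :=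
  rfl

/-- The quotient map `Z^r_p → E^r_p`. -/
def pageMkHom (K : ChainComplex AddCommGrpCat.{w} ℕ) (F : ℤ → ∀ n, AddSubgroup (K.X n))
    (r p : ℤ) (n : ℕ) : pageZ K F r p n →+ page K F r p n :=
  QuotientAddGroup.mk' _

theorem pageMkHom_apply {r p : ℤ} {n : ℕ} (x : pageZ K F r p n) :
    pageMkHom K F r p n x = pageMk K F x :=
  rfl

theorem mem_pageZ_succ {r p : ℤ} {n : ℕ} {x : K.X (n + 1)} :
    x ∈ pageZ K F r p (n + 1) ↔ x ∈ F p (n + 1) ∧ (K.d (n + 1) n).hom x ∈ F (p - r) n := by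
  rw [mem_pageZ]
  refine and_congr_right fun _ => ⟨fun h => h n, fun h m => ?_⟩
  by_cases hm : m = n
  · exact hm ▸ h
  · rw [K.d_apply_eq_zero_of_ne (by omega)]
    exact AddSubgroup.zero_mem _

theorem filtration_le (hmono : ∀ p n, F p n ≤ F (p + 1) n) {p q : ℤ} (h : p ≤ q) (n : ℕ) :
    F p n ≤ F q n := by
  obtain ⟨k, rfl⟩ := Int.le.dest h
  induction k with
  | zero => simp
  | succ k ih =>
    refine (ih (by omega)).trans ?_
    have := hmono (p + k) n
    rwa [add_assoc] at this

theorem pageZ_le_pageZ (hmono : ∀ p n, F p n ≤ F (p + 1) n) {r r' p p' : ℤ}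
    (h : p ≤ p') (h' : p - r ≤ p' - r') (n : ℕ) :
    pageZ K F r p n ≤ pageZ K F r' p' n := by
  intro x hx
  rw [mem_pageZ] at hx ⊢
  exact ⟨filtration_le hmono h n hx.1, fun m => filtration_le hmono h' m (hx.2 m)⟩

/-- The kernel of `d^r` consists of the classes of `Z^{r+1}`. -/
theorem dOut_pageMk_eq_zero_iff (hmono : ∀ p n, F p n ≤ F (p + 1) n) {r p : ℤ} {n : ℕ}
    (x : pageZ K F r p n) :
    dOut K F r p n (pageMk K F x) = 0 ↔
      ∃ y ∈ pageZ K F (r - 1) (p - 1) n, x.1 - y ∈ pageZ K F (r + 1) p n := by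
  unfold dOut
  rw [pageD_pageMk, pageMk_eq_zero_iff, mem_pageB]
  have hx := mem_pageZ.1 x.2
  constructor
  · intro h
    -- In total degree `0` the target degree `n - 1` is again `0` and the differential is the zero
    -- map, so no correction is needed.
    obtain _ | n := n
    · refine ⟨0, AddSubgroup.zero_mem _, ?_⟩
      rw [sub_zero, mem_pageZ]
      refine ⟨hx.1, fun m => ?_⟩
      rw [K.d_apply_eq_zero_of_ne (by omega)]
      exact AddSubgroup.zero_mem _
    -- From `∂x = a + ∂b` the correction is `b`: the boundary of `x - b` is `a`, one filtration step
    -- below where `∂x` had to lie.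
    · obtain ⟨a, ha, (b : K.X (n + 1)), hb, hab⟩ := h
      have hb' : b ∈ pageZ K F (r - 1) (p - 1) (n + 1) := by
        rwa [show p - r + r - 1 = p - 1 by ring] at hb
      refine ⟨b, hb', ?_⟩
      rw [mem_pageZ_succ]
      refine ⟨sub_mem hx.1 (filtration_le hmono (by omega) _ (mem_pageZ.1 hb').1), ?_⟩
      have h1 : (K.d (n + 1) n).hom (x.1 - b) = a := by
        rw [map_sub]
        exact sub_eq_iff_eq_add.2 hab.symm
      rw [h1, show p - (r + 1) = p - r - 1 by ring]
      exact (mem_pageZ.1 ha).1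
  · rintro ⟨y, hy, hxy⟩
    obtain _ | n := n
    · refine ⟨0, AddSubgroup.zero_mem _, 0, AddSubgroup.zero_mem _, ?_⟩
      exact (zero_add _).trans ((map_zero _).trans
        (K.d_apply_eq_zero_of_ne (by omega : 0 - 1 + 1 ≠ 0) x.1).symm)
    · refine ⟨(K.d (n + 1) n).hom (x.1 - y), mem_pageZ.2 ⟨?_, fun m => ?_⟩, y, ?_, ?_⟩
      · rw [show p - r - 1 = p - (r + 1) by ring]
        exact (mem_pageZ.1 hxy).2 n
      · refine (congrArg (· ∈ _) (K.d_d_apply (n + 1) n m (x.1 - y))).mpr (AddSubgroup.zero_mem _)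
      · rw [show p - r + r - 1 = p - 1 by ring]
        exact hy
      · rw [map_sub]
        exact sub_add_cancel _ _

/-- `E^{r+1}` is the homology of `E^r`. -/
theorem nextPageIsHomology (hmono : ∀ p n, F p n ≤ F (p + 1) n) (r : ℕ) (p : ℤ)
    (n : ℕ) : NextPageIsHomology K F r p n := by
  have hle : pageZ K F ((r : ℤ) + 1) p n ≤ pageZ K F r p n :=
    pageZ_le_pageZ hmono le_rfl (by omega) n
  refine ⟨?_, ?_⟩
  · rintro _ ⟨e, rfl⟩
    obtain ⟨x, rfl⟩ := pageMk_surjective e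
    rw [AddMonoidHom.mem_ker]
    unfold dIn dOut
    rw [pageD_pageMk, pageD_pageMk, pageMk_eq_zero_iff]
    exact (congrArg (· ∈ _) (K.d_d_apply _ _ _ x.1)).mpr (AddSubgroup.zero_mem _)
  have hker : ∀ x : pageZ K F ((r : ℤ) + 1) p n,
      pageMk K F ⟨x.1, hle x.2⟩ ∈ (dOut K F r p n).ker := fun x =>
    (dOut_pageMk_eq_zero_iff hmono _).2 ⟨0, AddSubgroup.zero_mem _, by rw [sub_zero]; exact x.2⟩
  let g : pageZ K F ((r : ℤ) + 1) p n →+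
      (dOut K F r p n).ker ⧸ (dIn K F r p n).range.addSubgroupOf (dOut K F r p n).ker :=
    (QuotientAddGroup.mk' _).comp
      (((pageMkHom K F r p n).comp (AddSubgroup.inclusion hle)).codRestrict _ hker)
  refine Exists.elim (exists_addEquiv_of_ker_eq (pageMkHom K F ((r : ℤ) + 1) p n) g
    pageMk_surjective ?_ fun x => ?_) fun φ hφ => ⟨φ, fun x h₁ h₂ h₃ => hφ ⟨x, h₁⟩⟩
  · intro e
    obtain ⟨⟨e, he⟩, rfl⟩ := QuotientAddGroup.mk_surjective e
    obtain ⟨x, rfl⟩ := pageMk_surjective e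
    obtain ⟨y, hy, hxy⟩ := (dOut_pageMk_eq_zero_iff hmono x).1 he
    -- The correction `y` lies in `Z^{r-1}_{p-1}`, so `x - y` represents the same class in `E^r`.
    refine ⟨⟨_, hxy⟩, congrArg QuotientAddGroup.mk (Subtype.ext ?_)⟩
    refine (QuotientAddGroup.eq_iff_sub_mem (N := (pageB K F r p n).addSubgroupOf _)).2 ?_
    change x.1 - y - x.1 ∈ pageB K F r p n
    rw [sub_sub_cancel_left]
    exact AddSubgroup.mem_sup_left (neg_mem hy)
  · rw [pageMkHom_apply, pageMk_eq_zero_iff]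
    refine Iff.trans ?_ (mk_eq_zero_iff_mem _).symm
    change _ ↔ pageMk K F ⟨x.1, hle x.2⟩ ∈ (dIn K F r p n).range
    rw [mem_pageB, show (r : ℤ) + 1 - 1 = r by ring, show p + ((r : ℤ) + 1) - 1 = p + r by ring]
    constructor
    · rintro ⟨a, ha, b, hb, hab⟩
      refine ⟨pageMk K F ⟨b, hb⟩, ?_⟩
      unfold dIn
      rw [pageD_pageMk]
      refine (QuotientAddGroup.eq_iff_sub_mem (N := (pageB K F r p n).addSubgroupOf _)).2 ?_
      change (K.d (n + 1) n).hom b - x.1 ∈ pageB K F r p n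
      rw [← hab, sub_add_cancel_right]
      exact AddSubgroup.mem_sup_left (neg_mem (mem_pageZ.2 ⟨(mem_pageZ.1 ha).1, fun m =>
        filtration_le hmono (by omega) _ ((mem_pageZ.1 ha).2 m)⟩))
    · rintro ⟨e, he⟩
      obtain ⟨b, rfl⟩ := pageMk_surjective e
      unfold dIn at he
      rw [pageD_pageMk] at he
      have h1 : x.1 - (K.d (n + 1) n).hom b.1 ∈ pageB K F r p n :=
        (QuotientAddGroup.eq_iff_sub_mem (N := (pageB K F r p n).addSubgroupOf _)).1 he.symm
      obtain ⟨a', ha', b', hb', hab⟩ := mem_pageB.1 h1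
      have hb2 : b' ∈ pageZ K F r (p + r) (n + 1) :=
        pageZ_le_pageZ hmono (by omega) (by omega) _ hb'
      refine ⟨a', mem_pageZ.2 ⟨(mem_pageZ.1 ha').1, fun m => ?_⟩, b' + b.1, add_mem hb2 b.2, ?_⟩
      -- `a'` differs from `x` by a boundary, so `∂a' = ∂x`. This lies in `F_{p-r-1}`, which
      -- improves `a' ∈ Z^{r-1}_{p-1}` to `a' ∈ Z^r_{p-1}`.
      · have h2 : a' = x.1 - (K.d (n + 1) n).hom (b' + b.1) := by
          rw [map_add, ← sub_sub, sub_right_comm, ← hab, add_sub_cancel_right]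
        rw [h2, map_sub, K.d_d_apply, sub_zero]
        exact filtration_le hmono (by omega) _ ((mem_pageZ.1 x.2).2 m)
      · rw [map_add, ← add_assoc, hab, sub_add_cancel]

/-! ### Convergence -/

/-- A filtration by subcomplexes that vanishes in negative degrees and is exhaustive. -/
structure IsConvergentFiltration (K : ChainComplex AddCommGrpCat.{w} ℕ)
    (F : ℤ → ∀ n, AddSubgroup (K.X n)) : Prop where
  mono (p : ℤ) (n : ℕ) : F p n ≤ F (p + 1) n
  eq_bot (p : ℤ) (n : ℕ) : p < 0 → F p n = ⊥
  exhaustive (n : ℕ) (x : K.X n) : ∃ p, x ∈ F p n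
  d_mem (p : ℤ) (m n : ℕ) (x : K.X m) : x ∈ F p m → (K.d m n).hom x ∈ F p n

theorem homologyFil_eq_bot (hF : IsConvergentFiltration K F) {p : ℤ} (hp : p < 0) (n : ℕ) :
    homologyFil K F p n = ⊥ := by
  rw [eq_bot_iff]
  rintro _ ⟨z, hz, rfl⟩
  have hz0 : (K.iCycles n).hom z = 0 := by
    have : (K.iCycles n).hom z ∈ F p n := hz
    rwa [hF.eq_bot p n hp, AddSubgroup.mem_bot] at this
  refine AddSubgroup.mem_bot.2 ((K.homologyπ_eq_zero_iff z).2 ⟨0, ?_⟩)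
  rw [hz0, map_zero]

theorem exists_mem_homologyFil (hF : IsConvergentFiltration K F) {n : ℕ} (h : K.homology n) :
    ∃ p, h ∈ homologyFil K F p n := by
  obtain ⟨z, rfl⟩ := K.homologyπ_surjective n h
  obtain ⟨p, hp⟩ := hF.exhaustive n ((K.iCycles n).hom z)
  exact ⟨p, z, hp, rfl⟩

/-- Translates the filtration of the homology to chains. The summand `a` need not be assumed a
cycle: it is the difference of a cycle and a boundary. -/
theorem mem_homologyFil_iff {p : ℤ} {n : ℕ} (z : K.cycles n) :
    (K.homologyπ n).hom z ∈ homologyFil K F p n ↔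
      ∃ a ∈ F p n, ∃ y : K.X (n + 1), a + (K.d (n + 1) n).hom y = (K.iCycles n).hom z := by
  constructor
  · rintro ⟨t, ht, h⟩
    have h0 : (K.homologyπ n).hom (z - t) = 0 := by rw [map_sub, sub_eq_zero]; exact h.symm
    obtain ⟨y, hy⟩ := (K.homologyπ_eq_zero_iff _).1 h0
    exact ⟨_, ht, y, by rw [hy, map_sub, add_sub_cancel]⟩
  · rintro ⟨a, ha, y, hay⟩
    obtain ⟨t, rfl⟩ := K.exists_iCycles_eq a (fun m => by
      rw [← add_sub_cancel_right a ((K.d (n + 1) n).hom y), hay, map_sub, K.d_d_apply,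
        K.d_iCycles_apply, sub_zero])
    refine ⟨t, ha, sub_eq_zero.1 ?_⟩
    rw [← map_sub, K.homologyπ_eq_zero_iff]
    exact ⟨-y, by rw [map_neg, map_sub, ← hay, sub_add_cancel_left]⟩

/-- A subquotient of `K.X n` represented by the cycles in `F_p`, in which a cycle is trivial if and
only if it is homologous to a cycle in `F_{p-1}`, is `F_p H_n / F_{p-1} H_n`. -/
theorem exists_addEquiv_homologyGr {p : ℤ} {n : ℕ} (Z B : AddSubgroup (K.X n))
    (hZF : Z ≤ F p n) (hZ : F p n ⊓ K.cycleSubgroup n ≤ Z)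
    (hsurj : ∀ x ∈ Z, ∃ y ∈ B, x - y ∈ K.cycleSubgroup n ∧ x - y ∈ F p n)
    (hker : ∀ x ∈ F p n, x ∈ K.cycleSubgroup n → (x ∈ B ↔
      ∃ a ∈ F (p - 1) n, ∃ y : K.X (n + 1), a + (K.d (n + 1) n).hom y = x)) :
    ∃ φ : Z ⧸ B.addSubgroupOf Z ≃+ homologyGr K F p n,
      ∀ (z : K.cycles n) (h₁ : (K.iCycles n).hom z ∈ Z)
        (h₂ : (K.homologyπ n).hom z ∈ homologyFil K F p n),
        φ (QuotientAddGroup.mk ⟨(K.iCycles n).hom z, h₁⟩) =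
          QuotientAddGroup.mk ⟨(K.homologyπ n).hom z, h₂⟩ := by
  let A : AddSubgroup (K.cycles n) := (F p n).comap (K.iCycles n).hom
  have hcyc : ∀ z : K.cycles n, (K.iCycles n).hom z ∈ K.cycleSubgroup n := fun z =>
    ChainComplex.mem_cycleSubgroup.2 fun m => K.d_iCycles_apply n m z
  let f : A →+ Z ⧸ B.addSubgroupOf Z := (QuotientAddGroup.mk' _).comp
    (((K.iCycles n).hom.comp A.subtype).codRestrict Z fun z => hZ ⟨z.2, hcyc z.1⟩)
  let g : A →+ homologyGr K F p n := (QuotientAddGroup.mk' _).comp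
    (((K.homologyπ n).hom.comp A.subtype).codRestrict _ fun z => ⟨z.1, z.2, rfl⟩)
  refine Exists.elim (exists_addEquiv_of_ker_eq f g ?_ ?_ fun z => ?_) fun φ hφ =>
    ⟨φ, fun z h₁ h₂ => hφ ⟨z, hZF h₁⟩⟩
  · intro e
    obtain ⟨⟨x, hx⟩, rfl⟩ := QuotientAddGroup.mk_surjective e
    obtain ⟨y, hy, hc, hxy⟩ := hsurj x hx
    obtain ⟨z, hz⟩ := K.exists_iCycles_eq (x - y) (ChainComplex.mem_cycleSubgroup.1 hc)
    refine ⟨⟨z, (congrArg (· ∈ F p n) hz).mpr hxy⟩, ?_⟩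
    refine (QuotientAddGroup.eq_iff_sub_mem (N := B.addSubgroupOf Z)).2 ?_
    change (K.iCycles n).hom z - x ∈ B
    rw [hz, sub_sub_cancel_left]
    exact neg_mem hy
  · intro e
    obtain ⟨⟨_, ⟨z, hz, rfl⟩⟩, rfl⟩ := QuotientAddGroup.mk_surjective e
    exact ⟨⟨z, hz⟩, rfl⟩
  · refine (mk_eq_zero_iff_mem _).trans (Iff.trans ?_ (mk_eq_zero_iff_mem _).symm)
    exact (hker _ z.2 (hcyc z.1)).trans (mem_homologyFil_iff z.1).symm

theorem cycle_mem_pageZ {r p : ℤ} {n : ℕ} {x : K.X n} (hx : x ∈ F p n)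
    (hc : x ∈ K.cycleSubgroup n) : x ∈ pageZ K F r p n :=
  mem_pageZ.2 ⟨hx, fun m => by
    rw [ChainComplex.mem_cycleSubgroup.1 hc m]
    exact AddSubgroup.zero_mem _⟩

/-- The boundary lies in `F_{p-r}`, which is zero because the filtration is bounded below. -/
theorem mem_cycleSubgroup_of_mem_pageZ (hF : IsConvergentFiltration K F) {r p : ℤ} {n : ℕ}
    {x : K.X n} (hx : x ∈ pageZ K F r p n) (h : p < r) : x ∈ K.cycleSubgroup n := by
  refine ChainComplex.mem_cycleSubgroup.2 fun m => ?_
  have := (mem_pageZ.1 hx).2 m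
  rwa [hF.eq_bot _ _ (by omega), AddSubgroup.mem_bot] at this

theorem sub_d_mem_cycleSubgroup {n : ℕ} {x a : K.X n} {y : K.X (n + 1)}
    (hx : x ∈ K.cycleSubgroup n) (h : a + (K.d (n + 1) n).hom y = x) :
    a ∈ K.cycleSubgroup n := by
  refine ChainComplex.mem_cycleSubgroup.2 fun m => ?_
  rw [← add_sub_cancel_right a ((K.d (n + 1) n).hom y), h, map_sub, K.d_d_apply,
    ChainComplex.mem_cycleSubgroup.1 hx, sub_zero]

/-- Boundedness below makes `Z^∞_p` the group of cycles in `F_p`. Exhaustiveness puts each bounding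
chain into some `F_s`, so its boundary is divided out on a finite page; that page may depend on the
chain, since the limit takes the boundaries of all pages. -/
theorem pageInfIsGr (hF : IsConvergentFiltration K F) (p : ℤ) (n : ℕ) : PageInfIsGr K F p n := by
  have hmem : ∀ x, x ∈ pageZInf K F p n ↔ ∀ r : ℕ, x ∈ pageZ K F r p n := fun x =>
    AddSubgroup.mem_iInf
  refine exists_addEquiv_homologyGr _ _ (fun x hx => (mem_pageZ.1 ((hmem x).1 hx 0)).1)
    (fun x hx => (hmem x).2 fun r => cycle_mem_pageZ hx.1 hx.2)
    (fun x hx => ⟨0, AddSubgroup.zero_mem _, ?_⟩) fun x hx hc => ⟨fun h => ?_, ?_⟩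
  · rw [sub_zero]
    exact ⟨mem_cycleSubgroup_of_mem_pageZ hF ((hmem x).1 hx (p.toNat + 1)) (by omega),
      (mem_pageZ.1 ((hmem x).1 hx 0)).1⟩
  · have hle : pageBInf K F p n ≤ F (p - 1) n ⊔ (K.d (n + 1) n).hom.range := by
      refine iSup_le fun r => sup_le_sup (fun x hx => (mem_pageZ.1 hx).1) ?_
      rintro _ ⟨y, -, rfl⟩
      exact ⟨y, rfl⟩
    obtain ⟨a, ha, _, ⟨y, rfl⟩, h⟩ := AddSubgroup.mem_sup.1 (hle h)
    exact ⟨a, ha, y, h⟩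
  · rintro ⟨a, ha, y, h⟩
    have hac := sub_d_mem_cycleSubgroup hc h
    obtain ⟨s, hs⟩ := hF.exhaustive _ y
    have hd : (K.d (n + 1) n).hom y ∈ F p n := by
      rw [← sub_eq_of_eq_add' h.symm]
      exact sub_mem hx (filtration_le hF.mono (by omega) _ ha)
    -- The page `r` has to satisfy `s ≤ p + r - 1`, so that `y ∈ F_s` is admissible in
    -- `Z^{r-1}_{p+r-1}`.
    refine AddSubgroup.mem_iSup_of_mem (s - p + 1).toNat (mem_pageB.2
      ⟨a, cycle_mem_pageZ ha hac, y, mem_pageZ_succ.2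
        ⟨filtration_le hF.mono (by omega) _ hs, ?_⟩, h⟩)
    exact filtration_le hF.mono (by omega) _ hd

/-- Vanishing outgoing differentials allow the boundary of a representative to be pushed down until
it is zero; vanishing incoming ones allow a bounding chain to be pushed down to `F_{p+r-1}`. -/
theorem pageIsGr_of_stableFrom (hF : IsConvergentFiltration K F) {r₀ : ℕ} {p : ℤ} {n : ℕ}
    (hst : StableFrom K F r₀ p n) (r : ℕ)
    (hr : r₀ ≤ r) : PageIsGr K F r p n := by
  refine exists_addEquiv_homologyGr _ _ (fun x hx => (mem_pageZ.1 hx).1)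
    (fun x hx => cycle_mem_pageZ hx.1 hx.2) (fun x hx => ?_) fun x hx hc => ⟨fun h => ?_, ?_⟩
  -- Each vanishing `d^{r+k}` supplies a further correction. All of them lie in `Z^{r-1}_{p-1}`, so
  -- their sum is zero in `E^r`.
  · have key : ∀ k : ℕ, ∃ y ∈ pageZ K F ((r : ℤ) - 1) (p - 1) n,
        x - y ∈ pageZ K F ((r + k : ℕ) : ℤ) p n := by
      intro k
      induction k with
      | zero => exact ⟨0, AddSubgroup.zero_mem _, by rw [sub_zero]; exact hx⟩
      | succ k ih =>
        obtain ⟨y, hy, hxy⟩ := ih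
        have h0 : dOut K F (r + k : ℕ) p n (pageMk K F ⟨x - y, hxy⟩) = 0 := by
          rw [(hst (r + k) (by omega)).1]
          rfl
        obtain ⟨y', hy', hxy'⟩ := (dOut_pageMk_eq_zero_iff hF.mono _).1 h0
        refine ⟨y + y', add_mem hy (pageZ_le_pageZ hF.mono le_rfl (by omega) _ hy'), ?_⟩
        rw [← sub_sub]
        exact_mod_cast hxy'
    obtain ⟨y, hy, hxy⟩ := key (p.toNat + 1)
    exact ⟨y, AddSubgroup.mem_sup_left hy, mem_cycleSubgroup_of_mem_pageZ hF hxy (by omega),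
      (mem_pageZ.1 hxy).1⟩
  · obtain ⟨a, ha, b, -, h⟩ := mem_pageB.1 h
    exact ⟨a, (mem_pageZ.1 ha).1, b, h⟩
  · rintro ⟨a, ha, y, h⟩
    have hd : (K.d (n + 1) n).hom y ∈ F p n := by
      rw [← sub_eq_of_eq_add' h.symm]
      exact sub_mem hx (filtration_le hF.mono (by omega) _ ha)
    -- Induction on the excess `k` of the bounding chain over `F_{p+r-1}`: if `d^{r+k}` kills the
    -- class of `y`, then `∂y = a + ∂b` with a cycle `a ∈ F_{p-1}` and with `b` one step lower than
    -- `y`.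
    have key : ∀ (k : ℕ) (y : K.X (n + 1)), y ∈ F (p + r - 1 + k) (n + 1) →
        (K.d (n + 1) n).hom y ∈ F p n → (K.d (n + 1) n).hom y ∈ pageB K F r p n := by
      intro k
      induction k with
      | zero =>
        intro y hy hd
        refine AddSubgroup.mem_sup_right (AddSubgroup.mem_map_of_mem _ (mem_pageZ_succ.2 ⟨?_, ?_⟩))
        · simpa using hy
        · rwa [show p + (r : ℤ) - 1 - (r - 1) = p by ring]
      | succ k ih =>
        intro y hy hd
        have hyZ : y ∈ pageZ K F (r + k : ℕ) (p + (r + k : ℕ)) (n + 1) := by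
          refine mem_pageZ_succ.2 ⟨filtration_le hF.mono (by push_cast; omega) _ hy, ?_⟩
          rwa [add_sub_cancel_right]
        have h0 : dIn K F (r + k : ℕ) p n (pageMk K F ⟨y, hyZ⟩) = 0 := by
          rw [(hst (r + k) (by omega)).2]
          rfl
        unfold dIn at h0
        rw [pageD_pageMk, pageMk_eq_zero_iff, mem_pageB] at h0
        obtain ⟨a, ha, b, hb, hab⟩ := h0
        have hc : a ∈ K.cycleSubgroup n := sub_d_mem_cycleSubgroup
          (ChainComplex.mem_cycleSubgroup.2 fun m => K.d_d_apply _ _ _ y) hab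
        rw [← show a + (K.d (n + 1) n).hom b = (K.d (n + 1) n).hom y from hab]
        refine add_mem (AddSubgroup.mem_sup_left (cycle_mem_pageZ (mem_pageZ.1 ha).1 hc))
          (ih b (filtration_le hF.mono (by push_cast; omega) _ (mem_pageZ.1 hb).1) ?_)
        exact filtration_le hF.mono (by omega) _ ((mem_pageZ_succ.1 hb).2)
    obtain ⟨s, hs⟩ := hF.exhaustive _ y
    rw [← h]
    exact add_mem (AddSubgroup.mem_sup_left
        (cycle_mem_pageZ ha (sub_d_mem_cycleSubgroup hc h)))
      (key (s - (p + r - 1)).toNat y (filtration_le hF.mono (by omega) _ hs) hd)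

theorem pageMk_eq_zero_of_neg (hF : IsConvergentFiltration K F) {r p : ℤ} {n : ℕ} (hp : p < 0)
    (e : page K F r p n) : e = 0 := by
  obtain ⟨x, rfl⟩ := pageMk_surjective e
  have hx : x.1 = 0 := by
    have := (mem_pageZ.1 x.2).1
    rwa [hF.eq_bot p n hp, AddSubgroup.mem_bot] at this
  rw [pageMk_eq_zero_iff, hx]
  exact AddSubgroup.zero_mem _

/-- Since `(p - 1) - (r - 1) = p - r`, the groups `Z^r_p` and `Z^{r-1}_{p-1}` impose the same
condition on the boundary. -/
theorem pageMk_eq_zero_of_le {r p : ℤ} {n : ℕ} (hp : F p n ≤ F (p - 1) n) (e : page K F r p n) :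
    e = 0 := by
  obtain ⟨x, rfl⟩ := pageMk_surjective e
  rw [pageMk_eq_zero_iff]
  refine AddSubgroup.mem_sup_left (mem_pageZ.2 ⟨hp (mem_pageZ.1 x.2).1, fun m => ?_⟩)
  rw [show p - 1 - (r - 1) = p - r by ring]
  exact (mem_pageZ.1 x.2).2 m

/-- If the filtration is finite in total degrees `n` and `n + 1`, the terms of total degree `n`
are constant from some page on. -/
theorem stableFrom_of_eq_top (hF : IsConvergentFiltration K F) {n N : ℕ} (h₀ : F N n = ⊤)
    (h₁ : F N (n + 1) = ⊤) (p : ℤ) :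
    StableFrom K F (N + 1) p n := by
  have htop : ∀ {q : ℤ} {m : ℕ}, F N m = ⊤ → N < q → F q m ≤ F (q - 1) m := by
    intro q m hm hq
    have h : F N m ≤ F (q - 1) m := filtration_le hF.mono (by omega) m
    rw [hm, top_le_iff] at h
    rw [h]
    exact le_top
  -- A differential lowers the filtration degree by `r > N`, so its target index is negative or its
  -- source index exceeds `N`; in either case one end is zero.
  refine fun r hr => ⟨AddMonoidHom.ext fun e => ?_, AddMonoidHom.ext fun e => ?_⟩
  · by_cases hp : p - r < 0
    · exact pageMk_eq_zero_of_neg hF hp _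
    · rw [pageMk_eq_zero_of_le (htop h₀ (by omega)) e, map_zero, map_zero]
  · by_cases hp : p < 0
    · exact pageMk_eq_zero_of_neg hF hp _
    · rw [pageMk_eq_zero_of_le (htop h₁ (by omega)) e, map_zero, map_zero]

end SpectralSequence

/-! ### Normalization of chains -/

section Normalization

open AlgebraicTopology AlgebraicTopology.DoldKan

variable {Y : SimplicialObject AddCommGrpCat.{w}}
  {A : ∀ n : ℕ, AddSubgroup ((AlternatingFaceMapComplex.obj Y).X n)}

/-- The operators `hσ'` are zero or a degeneracy up to sign. The target family `B` is kept apart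
from `A` so that the same estimate also detects degenerate values. -/
theorem hσ_mem {B : ∀ n : ℕ, AddSubgroup ((AlternatingFaceMapComplex.obj Y).X n)}
    (hσ : ∀ (n : ℕ) (i : Fin (n + 1)), ∀ x ∈ A n, (Y.σ i).hom x ∈ B (n + 1))
    (q n : ℕ) : ∀ x ∈ A n, (hσ' (X := Y) q n (n + 1) rfl).hom x ∈ B (n + 1) := by
  intro x hx
  by_cases h : n < q
  · have h0 : hσ' (X := Y) q n (n + 1) rfl = 0 := hσ'_eq_zero h _
    exact (congrArg (fun g => AddCommGrpCat.Hom.hom g x ∈ B (n + 1)) h0).mpr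
      (AddSubgroup.zero_mem _)
  · have h0 := hσ'_eq' (X := Y) (q := q) (n := n) (a := n - q) (by omega)
    have e : ∀ (k : ℤ) (g : (AlternatingFaceMapComplex.obj Y).X n ⟶
        (AlternatingFaceMapComplex.obj Y).X (n + 1)), (k • g).hom x = k • g.hom x := fun _ _ => rfl
    refine (congrArg (fun g => AddCommGrpCat.Hom.hom g x ∈ B (n + 1)) h0).mpr ?_
    exact (congrArg (· ∈ B (n + 1)) (e _ _)).mpr (zsmul_mem (hσ n _ x hx) _)

theorem Hσ_mem
    (hσ : ∀ (n : ℕ) (i : Fin (n + 1)), ∀ x ∈ A n, (Y.σ i).hom x ∈ A (n + 1))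
    (hd : ∀ n, ∀ x ∈ A (n + 1), ((AlternatingFaceMapComplex.obj Y).d (n + 1) n).hom x ∈ A n)
    (q n : ℕ) : ∀ x ∈ A n, ((Hσ (X := Y) q).f n).hom x ∈ A n := by
  intro x hx
  obtain _ | n := n
  · rw [Hσ_eq_zero]
    exact AddSubgroup.zero_mem _
  · unfold Hσ
    rw [Homotopy.nullHomotopicMap'_f (c_mk (n + 2) (n + 1) rfl) (c_mk (n + 1) n rfl)]
    exact add_mem (hσ_mem hσ q n _ (hd n _ hx)) (hd _ _ (hσ_mem hσ q (n + 1) _ hx))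

theorem P_mem
    (hσ : ∀ (n : ℕ) (i : Fin (n + 1)), ∀ x ∈ A n, (Y.σ i).hom x ∈ A (n + 1))
    (hd : ∀ n, ∀ x ∈ A (n + 1), ((AlternatingFaceMapComplex.obj Y).d (n + 1) n).hom x ∈ A n)
    (q n : ℕ) : ∀ x ∈ A n, ((P (X := Y) q).f n).hom x ∈ A n := by
  induction q with
  | zero => exact fun x hx => hx
  | succ q ih =>
    intro x hx
    exact add_mem (ih _ hx) (Hσ_mem hσ hd q n _ (ih _ hx))

/-- Passing from `P q` to `P (q + 1)` adds to the homotopy the map `P q` followed by `hσ' q`. The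
projectors preserve `A`, and the last operation is a degeneracy, so the values lie in any `B` that
receives the degeneracies of `A`. -/
theorem homotopyPToId_mem
    (hσ : ∀ (n : ℕ) (i : Fin (n + 1)), ∀ x ∈ A n, (Y.σ i).hom x ∈ A (n + 1))
    (hd : ∀ n, ∀ x ∈ A (n + 1), ((AlternatingFaceMapComplex.obj Y).d (n + 1) n).hom x ∈ A n)
    {B : ∀ n : ℕ, AddSubgroup ((AlternatingFaceMapComplex.obj Y).X n)}
    (hB : ∀ (n : ℕ) (i : Fin (n + 1)), ∀ x ∈ A n, (Y.σ i).hom x ∈ B (n + 1)) (q n : ℕ) :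
    ∀ x ∈ A n, ((homotopyPToId Y q).hom n (n + 1)).hom x ∈ B (n + 1) := by
  induction q with
  | zero => exact fun x hx => AddSubgroup.zero_mem _
  | succ q ih =>
    intro x hx
    have h0 : (homotopyHσToZero (X := Y) q).hom n (n + 1) = hσ' q n (n + 1) rfl := by
      simp [homotopyHσToZero]
    have h : (homotopyPToId Y (q + 1)).hom n (n + 1) =
        (homotopyPToId Y q).hom n (n + 1) + (P q).f n ≫ hσ' q n (n + 1) rfl := by
      rw [← h0]
      simp [homotopyPToId, Homotopy.compLeft]
    rw [h]
    exact add_mem (ih _ hx) (hσ_mem hB q n _ (P_mem hσ hd q n _ hx))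

end Normalization

/-! ### Normalization of the chains on a simplicial set -/

section SimplicialNormalization

open AlgebraicTopology AlgebraicTopology.DoldKan

variable (X : SSet.{w})

/-- The free simplicial abelian group on a simplicial set. -/
abbrev freeSimplicial : SimplicialObject AddCommGrpCat.{w} :=
  ((SimplicialObject.whiskering _ _).obj freeAb).obj X

theorem freeSimplicial_σ {n : ℕ} (i : Fin (n + 1)) (s : X _⦋n⦌) :
    ((freeSimplicial X).σ i).hom (simplexChain s) = simplexChain (X.σ i s) :=
  Finsupp.mapDomain_single

/-- The normalization map: a natural projection of the chains that kills the degenerate ones. -/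
def normalization (n : ℕ) : (simplicialChains.obj X).X n →+ (simplicialChains.obj X).X n :=
  ((PInfty (X := freeSimplicial X)).f n).hom

/-- The homotopy from the normalization map to the identity. -/
def normalizationHomotopy (n : ℕ) :
    (simplicialChains.obj X).X n →+ (simplicialChains.obj X).X (n + 1) :=
  ((homotopyPInftyToId (freeSimplicial X)).hom n (n + 1)).hom

theorem normalization_d (m n : ℕ) (x : (simplicialChains.obj X).X m) :
    ((simplicialChains.obj X).d m n).hom (normalization X m x) =
      normalization X n (((simplicialChains.obj X).d m n).hom x) :=
  congrArg (fun f => AddCommGrpCat.Hom.hom f x) ((PInfty (X := freeSimplicial X)).comm m n)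

theorem normalization_of_mem_degenerateChains {n : ℕ} {x : (simplicialChains.obj X).X n}
    (hx : x ∈ degenerateChains X n) : normalization X n x = 0 := by
  revert x
  change degenerateChains X n ≤ (normalization X n).ker
  refine (AddSubgroup.closure_le _).2 ?_
  rintro _ ⟨s, hs, rfl⟩
  obtain _ | n := n
  · simp at hs
  rw [SSet.degenerate_eq_iUnion_range_σ, Set.mem_iUnion] at hs
  obtain ⟨i, t, rfl⟩ := hs
  rw [← freeSimplicial_σ]
  exact congrArg (fun f => AddCommGrpCat.Hom.hom f (simplexChain t))
    (σ_comp_PInfty (freeSimplicial X) i)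

theorem normalization_zero (x : (simplicialChains.obj X).X 0) :
    normalization X 0 x =
      ((simplicialChains.obj X).d 1 0).hom (normalizationHomotopy X 0 x) + x := by
  have h := (homotopyPInftyToId (freeSimplicial X)).comm 0
  rw [Homotopy.dNext_zero_chainComplex, Homotopy.prevD_chainComplex, zero_add] at h
  exact congrArg (fun f => AddCommGrpCat.Hom.hom f x) h

theorem normalization_succ (n : ℕ) (x : (simplicialChains.obj X).X (n + 1)) :
    normalization X (n + 1) x =
      normalizationHomotopy X n (((simplicialChains.obj X).d (n + 1) n).hom x) +
      ((simplicialChains.obj X).d (n + 2) (n + 1)).hom (normalizationHomotopy X (n + 1) x) +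
      x := by
  have h := (homotopyPInftyToId (freeSimplicial X)).comm (n + 1)
  rw [Homotopy.dNext_succ_chainComplex, Homotopy.prevD_chainComplex] at h
  exact congrArg (fun f => AddCommGrpCat.Hom.hom f x) h

variable {X}

theorem chainSpan_σ {S T : ∀ n, Set (X _⦋n⦌)}
    (hσ : ∀ (n : ℕ) (i : Fin (n + 1)), ∀ s ∈ S n, X.σ i s ∈ T (n + 1)) (n : ℕ)
    (i : Fin (n + 1)) :
    ∀ x ∈ chainSpan (S n), ((freeSimplicial X).σ i).hom x ∈ chainSpan (T (n + 1)) := by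
  change chainSpan (S n) ≤ (chainSpan (T (n + 1))).comap ((freeSimplicial X).σ i).hom
  refine (AddSubgroup.closure_le _).2 ?_
  rintro _ ⟨s, hs, rfl⟩
  refine (congrArg (· ∈ chainSpan (T (n + 1))) (freeSimplicial_σ X i s)).mpr ?_
  exact AddSubgroup.subset_closure (Set.mem_image_of_mem _ (hσ n i s hs))

theorem normalization_mem_chainSpan {S : ∀ n, Set (X _⦋n⦌)}
    (hσ : ∀ (n : ℕ) (i : Fin (n + 1)), ∀ s ∈ S n, X.σ i s ∈ S (n + 1))
    (hδ : ∀ (n : ℕ) (i : Fin (n + 2)), ∀ s ∈ S (n + 1), X.δ i s ∈ S n) {n : ℕ}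
    {x : (simplicialChains.obj X).X n}
    (hx : x ∈ chainSpan (S n)) : normalization X n x ∈ chainSpan (S n) :=
  P_mem (Y := freeSimplicial X) (A := fun n => chainSpan (S n)) (chainSpan_σ hσ)
    (fun n _ hx => chainSpan_d_le_of_face S (fun n s hs i => hδ n i s hs) _ n hx) n n x hx

/-- With `T = S` this says that the homotopy respects a filtration step; with `T` the degenerate
simplices, that its values are degenerate. -/
theorem normalizationHomotopy_mem_chainSpan {S T : ∀ n, Set (X _⦋n⦌)}
    (hσ : ∀ (n : ℕ) (i : Fin (n + 1)), ∀ s ∈ S n, X.σ i s ∈ S (n + 1))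
    (hδ : ∀ (n : ℕ) (i : Fin (n + 2)), ∀ s ∈ S (n + 1), X.δ i s ∈ S n)
    (hT : ∀ (n : ℕ) (i : Fin (n + 1)), ∀ s ∈ S n, X.σ i s ∈ T (n + 1)) {n : ℕ}
    {x : (simplicialChains.obj X).X n} (hx : x ∈ chainSpan (S n)) :
    normalizationHomotopy X n x ∈ chainSpan (T (n + 1)) :=
  -- The component `n → n + 1` of `homotopyPInftyToId` is that of `homotopyPToId` at stage `n + 2`.
  homotopyPToId_mem (Y := freeSimplicial X) (A := fun n => chainSpan (S n)) (chainSpan_σ hσ)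
    (fun n _ hx => chainSpan_d_le_of_face S (fun n s hs i => hδ n i s hs) _ n hx)
    (B := fun n => chainSpan (T n)) (chainSpan_σ hT) (n + 2) n x hx

theorem chainSpan_univ (n : ℕ) : chainSpan (Set.univ : Set (X _⦋n⦌)) = ⊤ := by
  refine eq_top_iff.2 fun x _ => ?_
  induction (show X _⦋n⦌ →₀ ℤ from x) using Finsupp.induction_linear with
  | zero => exact AddSubgroup.zero_mem _
  | add f g hf hg => exact add_mem hf hg
  | single s k =>
    have h : (Finsupp.single s k : X _⦋n⦌ →₀ ℤ) = k • Finsupp.single s 1 := by simp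
    exact (congrArg (· ∈ chainSpan (Set.univ : Set (X _⦋n⦌))) h).mpr
      (zsmul_mem (AddSubgroup.subset_closure (Set.mem_image_of_mem _ (Set.mem_univ s))) k)

theorem normalizationHomotopy_mem_degenerateChains {n : ℕ} (x : (simplicialChains.obj X).X n) :
    normalizationHomotopy X n x ∈ degenerateChains X (n + 1) :=
  normalizationHomotopy_mem_chainSpan (S := fun _ => Set.univ) (T := X.degenerate)
    (fun _ _ _ _ => Set.mem_univ _) (fun _ _ _ _ => Set.mem_univ _)
    (fun _ _ _ _ => SSet.σ_mem_degenerate _ _ _) (by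
      rw [chainSpan_univ]
      exact AddSubgroup.mem_top _)

/-- A chain in a simplicial subset `S`, with boundary in `T`, is its normalization up to the
boundary of a degenerate chain in `S` and a degenerate chain in `T`. -/
theorem exists_eq_normalization_add {S T : ∀ n, Set (X _⦋n⦌)}
    (hS : ∀ {n : ℕ} {x : (simplicialChains.obj X).X n}, x ∈ chainSpan (S n) →
      normalizationHomotopy X n x ∈ chainSpan (S (n + 1)))
    (hT : ∀ {n : ℕ} {x : (simplicialChains.obj X).X n}, x ∈ chainSpan (T n) →
      normalizationHomotopy X n x ∈ chainSpan (T (n + 1)))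
    {n : ℕ} {x : (simplicialChains.obj X).X n} (hx : x ∈ chainSpan (S n))
    (hdx : ∀ m, ((simplicialChains.obj X).d n m).hom x ∈ chainSpan (T m)) :
    ∃ a ∈ chainSpan (S (n + 1)), ∃ b ∈ chainSpan (T n), a ∈ degenerateChains X (n + 1) ∧
      b ∈ degenerateChains X n ∧
      x = normalization X n x + b + ((simplicialChains.obj X).d (n + 1) n).hom a := by
  refine ⟨-normalizationHomotopy X n x, neg_mem (hS hx), ?_⟩
  have hD := neg_mem (normalizationHomotopy_mem_degenerateChains x)
  obtain _ | n := n
  · refine ⟨0, AddSubgroup.zero_mem _, hD, AddSubgroup.zero_mem _, ?_⟩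
    rw [normalization_zero, map_neg]
    abel
  · refine ⟨_, neg_mem (hT (hdx n)), hD,
      neg_mem (normalizationHomotopy_mem_degenerateChains _), ?_⟩
    rw [normalization_succ, map_neg]
    abel

theorem sub_normalization_mem_degenerateChains {n : ℕ} (x : (simplicialChains.obj X).X n) :
    x - normalization X n x ∈ degenerateChains X n := by
  have h : ∀ {n : ℕ} (x : (simplicialChains.obj X).X n), x ∈ chainSpan (Set.univ : Set (X _⦋n⦌)) :=
    fun x => by rw [chainSpan_univ]; exact AddSubgroup.mem_top _
  obtain ⟨a, -, b, -, ha, hb, hx⟩ := exists_eq_normalization_add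
    (S := fun _ => Set.univ) (T := fun _ => Set.univ) (fun _ => h _) (fun _ => h _) (h x)
    fun _ => h _
  nth_rw 1 [hx]
  rw [add_assoc, add_sub_cancel_left]
  exact add_mem hb (degenerateChains_d X _ _ ha)

end SimplicialNormalization

/-! ### The filtered nerve -/

namespace FsetCategory

variable {C : Type u} [FsetCategory.{u, v} C]

/-- Each morphism of the reindexed string is the composite of a block of consecutive morphisms of
`s`, or an identity if the block is empty. Monotonicity makes the blocks disjoint, so their weights
add up to at most the total weight of `s`. This covers faces and degeneracies at once. -/
theorem InFil.map {m n : ℕ} {s : ComposableArrows C n} {ℓ : ℝ} (h : InFil s ℓ)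
    (α : ⦋m⦌ ⟶ ⦋n⦌) : InFil (C := C) (n := m) ((nerve C).map α.op s) ℓ := by
  obtain ⟨w, hw, hle⟩ := h
  let θ : Fin (m + 1) →o Fin (n + 1) := α.toOrderHom
  let W : Fin (n + 1) → ℝ≥0 := fun a => ∑ i with i.castSucc < a, w i
  have hW : Monotone W := fun a b hab => Finset.sum_le_sum_of_subset fun i hi => by
    simp only [Finset.mem_filter, Finset.mem_univ, true_and] at hi ⊢
    exact hi.trans_le hab
  refine ⟨fun j => W (θ j.succ) - W (θ j.castSucc), fun j => ?_, le_trans ?_ hle⟩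
  · exact map_mem_fil s w hw _ _ (θ.monotone j.castSucc_le_succ)
  -- The partial sums are extended to `ℕ` by a constant beyond `m`, so that a monotone telescoping
  -- sum over a range applies.
  · let f : ℕ → ℝ≥0 := fun k => W (θ (Fin.ofNat (m + 1) (min k m)))
    have hf : Monotone f := fun a b hab => hW (θ.monotone (by
      rw [Fin.le_def, Fin.val_ofNat, Fin.val_ofNat, Nat.mod_eq_of_lt (by omega),
        Nat.mod_eq_of_lt (by omega)]
      omega))
    have h1 : ∑ j : Fin m, (W (θ j.succ) - W (θ j.castSucc)) =
        ∑ j : Fin m, (f (j + 1) - f j) := by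
      refine Finset.sum_congr rfl fun j _ => ?_
      have hj := j.isLt
      have e1 : Fin.ofNat (m + 1) (min ((j : ℕ) + 1) m) = j.succ := by
        rw [Fin.ext_iff, Fin.val_ofNat, Nat.mod_eq_of_lt (by omega), Fin.val_succ]
        omega
      have e2 : Fin.ofNat (m + 1) (min (j : ℕ) m) = j.castSucc := by
        rw [Fin.ext_iff, Fin.val_ofNat, Nat.mod_eq_of_lt (by omega), Fin.val_castSucc]
        omega
      simp only [f, e1, e2]
    rw [h1, Fin.sum_univ_eq_sum_range (fun k => f (k + 1) - f k) m, Finset.sum_range_tsub hf]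
    refine NNReal.coe_le_coe.2 (tsub_le_self.trans ?_)
    exact Finset.sum_le_sum_of_subset (Finset.filter_subset _ _)

theorem InFil.mono {n : ℕ} {s : ComposableArrows C n} {ℓ ℓ' : ℝ} (h : InFil s ℓ) (hℓ : ℓ ≤ ℓ') :
    InFil s ℓ' := by
  obtain ⟨w, hw, hle⟩ := h
  exact ⟨w, hw, hle.trans hℓ⟩

theorem InFil.nonneg {n : ℕ} {s : ComposableArrows C n} {ℓ : ℝ} (h : InFil s ℓ) : 0 ≤ ℓ := by
  obtain ⟨w, -, hle⟩ := h
  exact (NNReal.coe_nonneg _).trans hle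

theorem exists_inFil {n : ℕ} (s : ComposableArrows C n) : ∃ ℓ : ℝ, InFil s ℓ := by
  choose w hw using fun i : Fin n => fil_exhaustive (s.map (homOfLE i.castSucc_le_succ))
  exact ⟨_, w, hw, le_rfl⟩

/-- The degree is the least admissible weight, so the degrees are the optimal choice of weights. -/
theorem InFil.of_hasDegree {n : ℕ} {s : ComposableArrows C n} {k : Fin n → ℕ}
    (hk : ∀ i : Fin n, HasDegree (s.map (homOfLE i.castSucc_le_succ)) (k i : ℝ≥0)) {ℓ : ℝ} :
    InFil s ℓ ↔ ((∑ i, k i : ℕ) : ℝ) ≤ ℓ := by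
  constructor
  · rintro ⟨w, hw, hle⟩
    refine le_trans ?_ hle
    have h : ((∑ i, k i : ℕ) : ℝ≥0) ≤ ∑ i, w i := by
      push_cast
      exact Finset.sum_le_sum fun i _ => not_lt.1 fun h => (hk i).2 _ h (hw i)
    exact_mod_cast NNReal.coe_le_coe.2 h
  · intro h
    refine ⟨fun i => k i, fun i => (hk i).1, le_of_eq_of_le ?_ h⟩
    push_cast
    rfl

/-- The total degree is an integer. This makes `(FC_• C)_{<p}` the preceding step `F_{p-1}` of the
integral filtration. -/
theorem IsIntegral.inFil_sub_one (hC : IsIntegral C) {n : ℕ} {s : ComposableArrows C n} {p : ℤ}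
    {ℓ : ℝ} (h : InFil s ℓ) (hℓ : ℓ < p) : InFil s ((p - 1 : ℤ) : ℝ) := by
  choose k hk using fun i : Fin n => hC _ _ (s.map (homOfLE i.castSucc_le_succ))
  rw [InFil.of_hasDegree hk] at h ⊢
  have h1 : ((∑ i, k i : ℕ) : ℤ) < p := by
    have h2 := h.trans_lt hℓ
    exact_mod_cast h2
  have h2 : ((∑ i, k i : ℕ) : ℤ) ≤ p - 1 := by omega
  exact_mod_cast h2

theorem inFil_of_bound {M : ℝ≥0} (hM : ∀ (a b : C) (f : a ⟶ b), f ∈ fil a b M) {n : ℕ}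
    (s : ComposableArrows C n) {ℓ : ℝ} (h : n * M ≤ ℓ) : InFil s ℓ :=
  ⟨fun _ => M, fun _ => hM _ _ _, by simpa using h⟩

variable (C)

theorem FCle_mono {ℓ ℓ' : ℝ} (h : ℓ ≤ ℓ') (n : ℕ) : FCle C ℓ n ≤ FCle C ℓ' n :=
  AddSubgroup.closure_mono (Set.image_mono fun _ hs => InFil.mono hs h)

theorem FCle_of_neg {ℓ : ℝ} (h : ℓ < 0) (n : ℕ) : FCle C ℓ n = ⊥ := by
  refine (AddSubgroup.closure_eq_bot_iff).2 ?_
  rintro _ ⟨s, hs, rfl⟩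
  exact absurd (InFil.nonneg hs) (not_le.2 h)

theorem exists_mem_FCle {n : ℕ} (x : (FC C).X n) : ∃ p : ℤ, x ∈ FCle C (p : ℝ) n := by
  have hx : x ∈ chainSpan (X := nerve C) Set.univ := by
    rw [chainSpan_univ]
    exact AddSubgroup.mem_top _
  refine AddSubgroup.closure_induction ?_ ?_ ?_ ?_ hx
  · rintro _ ⟨s, -, rfl⟩
    obtain ⟨ℓ, h⟩ := exists_inFil (C := C) (n := n) s
    exact ⟨⌈ℓ⌉, AddSubgroup.subset_closure (Set.mem_image_of_mem _ (h.mono (Int.le_ceil ℓ)))⟩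
  · exact ⟨0, AddSubgroup.zero_mem _⟩
  · rintro x y - - ⟨p, hp⟩ ⟨q, hq⟩
    exact ⟨max p q, add_mem (FCle_mono C (by exact_mod_cast le_max_left p q) n hp)
      (FCle_mono C (by exact_mod_cast le_max_right p q) n hq)⟩
  · rintro x - ⟨p, hp⟩
    exact ⟨p, neg_mem hp⟩

theorem isConvergentFiltration : IsConvergentFiltration (FC C) (FCfil C) where
  mono p n := FCle_mono C (by push_cast; linarith) n
  eq_bot p n h := FCle_of_neg C (by exact_mod_cast h) n
  exhaustive n x := exists_mem_FCle C x
  d_mem p m n _ hx := FCle_d C p m n hx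

variable {C}

theorem FCle_eq_top_of_bound {M : ℝ≥0} (hM : ∀ (a b : C) (f : a ⟶ b), f ∈ fil a b M) {n : ℕ}
    {ℓ : ℝ} (h : n * M ≤ ℓ) : FCle C ℓ n = ⊤ := by
  refine Eq.trans ?_ (chainSpan_univ (X := nerve C) n)
  exact congrArg chainSpan (Set.eq_univ_of_forall fun s => inFil_of_bound hM _ h)

theorem IsIntegral.FClt_eq (hC : IsIntegral C) (p : ℤ) (n : ℕ) :
    FClt C p n = FCfil C (p - 1) n := by
  refine congrArg chainSpan (Set.ext fun s => ⟨?_, fun h => ⟨_, ?_, h⟩⟩)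
  · rintro ⟨ℓ, hℓ, h⟩
    exact hC.inFil_sub_one h hℓ
  · push_cast
    linarith

/-! ### Normalization of the filtered chains -/

variable (C)

/-- The `n`-simplices of the nerve in the `ℓ`-th filtration step. -/
def filteredNerve (ℓ : ℝ) (n : ℕ) : Set ((nerve C) _⦋n⦌) := {s | InFil (C := C) (n := n) s ℓ}

theorem σ_mem_filteredNerve (ℓ : ℝ) (n : ℕ) (i : Fin (n + 1)) :
    ∀ s ∈ filteredNerve C ℓ n, (nerve C).σ i s ∈ filteredNerve C ℓ (n + 1) :=
  fun _ hs => InFil.map hs (SimplexCategory.σ i)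

theorem δ_mem_filteredNerve (ℓ : ℝ) (n : ℕ) (i : Fin (n + 2)) :
    ∀ s ∈ filteredNerve C ℓ (n + 1), (nerve C).δ i s ∈ filteredNerve C ℓ n :=
  fun _ hs => InFil.map hs (SimplexCategory.δ i)

/-- The normalization map of `FC_• C`. -/
def normalize (n : ℕ) : (FC C).X n →+ (FC C).X n :=
  normalization (nerve C) n

theorem normalize_d (m n : ℕ) (x : (FC C).X m) :
    ((FC C).d m n).hom (normalize C m x) = normalize C n (((FC C).d m n).hom x) :=
  normalization_d (nerve C) m n x

theorem normalize_of_mem_FCdeg {n : ℕ} {x : (FC C).X n} (hx : x ∈ FCdeg C n) :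
    normalize C n x = 0 :=
  normalization_of_mem_degenerateChains (nerve C) hx

theorem sub_normalize_mem_FCdeg {n : ℕ} (x : (FC C).X n) : x - normalize C n x ∈ FCdeg C n :=
  sub_normalization_mem_degenerateChains (X := nerve C) x

theorem normalize_mem_FCle {ℓ : ℝ} {n : ℕ} {x : (FC C).X n} (hx : x ∈ FCle C ℓ n) :
    normalize C n x ∈ FCle C ℓ n :=
  normalization_mem_chainSpan (S := filteredNerve C ℓ) (σ_mem_filteredNerve C ℓ)
    (δ_mem_filteredNerve C ℓ) hx

/-- A chain in `F_p` with boundary in `F_{p'}` is its normalization up to the boundary of a chain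
in `F_p` and a chain in `F_{p'}`. -/
theorem exists_eq_normalize_add {ℓ ℓ' : ℝ} {n : ℕ} {x : (FC C).X n} (hx : x ∈ FCle C ℓ n)
    (hdx : ∀ m, ((FC C).d n m).hom x ∈ FCle C ℓ' m) :
    ∃ a ∈ FCle C ℓ (n + 1), ∃ b ∈ FCle C ℓ' n,
      x = normalize C n x + b + ((FC C).d (n + 1) n).hom a := by
  have h : ∀ (ℓ : ℝ) {n : ℕ} {x : (simplicialChains.obj (nerve C)).X n},
      x ∈ chainSpan (filteredNerve C ℓ n) →
      normalizationHomotopy (nerve C) n x ∈ chainSpan (filteredNerve C ℓ (n + 1)) := fun ℓ =>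
    normalizationHomotopy_mem_chainSpan (σ_mem_filteredNerve C ℓ) (δ_mem_filteredNerve C ℓ)
      (σ_mem_filteredNerve C ℓ)
  obtain ⟨a, ha, b, hb, -, -, h⟩ := exists_eq_normalization_add
    (S := filteredNerve C ℓ) (T := filteredNerve C ℓ') (h ℓ) (h ℓ') hx hdx
  exact ⟨a, ha, b, hb, h⟩

/-- The quotient map from `(FC_n C)_ℓ` to the magnitude chain complex. -/
def MCMkHom (ℓ : ℝ) (n : ℕ) : FCle C ℓ n →+ (MC C ℓ).X n :=
  QuotientAddGroup.mk' ((FClt C ℓ n ⊔ FCdeg C n).addSubgroupOf (FCle C ℓ n))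

theorem MCMkHom_surjective (ℓ : ℝ) (n : ℕ) : Function.Surjective (MCMkHom C ℓ n) :=
  QuotientAddGroup.mk_surjective

theorem d_MCMkHom (ℓ : ℝ) (k m : ℕ) (x : FCle C ℓ k) :
    ((MC C ℓ).d k m).hom (MCMkHom C ℓ k x) =
      MCMkHom C ℓ m ⟨((FC C).d k m).hom x.1, FCle_d C ℓ k m x.2⟩ :=
  rfl

/-! ### The first two pages -/

variable {C}

/-- `E^0` is the un-normalized magnitude chain complex. -/
theorem IsIntegral.exists_pageZero_equiv (hC : IsIntegral C) (p : ℤ) :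
    ∃ φ : ∀ n : ℕ, E C 0 p n ≃+ (unnormalizedMC C p).X n,
      (∀ (n : ℕ) (x : pageZ (FC C) (FCfil C) 0 p n),
        φ n (pageMk _ _ x) = unnormalizedMCMk C ⟨x.1, x.2.1⟩) ∧
      ∀ (n m : ℕ) (e : E C 0 p n),
        φ m (pageD (FC C) (FCfil C) 0 (add_zero p) n m e) =
          ((unnormalizedMC C p).d n m).hom (φ n e) := by
  have hF := isConvergentFiltration C
  have hex : ∀ n : ℕ, ∃ φ : E C 0 p n ≃+ (unnormalizedMC C p).X n,
      ∀ x : pageZ (FC C) (FCfil C) 0 p n,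
        φ (pageMk _ _ x) = unnormalizedMCMk C ⟨x.1, x.2.1⟩ := by
    intro n
    let g : pageZ (FC C) (FCfil C) 0 p n →+ (unnormalizedMC C p).X n :=
      (QuotientAddGroup.mk' ((FClt C p n).addSubgroupOf (FCle C p n))).comp
        (AddSubgroup.inclusion inf_le_left)
    refine exists_addEquiv_of_ker_eq (pageMkHom (FC C) (FCfil C) 0 p n) g pageMk_surjective
      (fun e => ?_) fun x => ?_
    · obtain ⟨⟨x, hx⟩, rfl⟩ := QuotientAddGroup.mk_surjective e
      refine ⟨⟨x, mem_pageZ.2 ⟨hx, fun m => ?_⟩⟩, rfl⟩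
      rw [sub_zero]
      exact FCle_d C p n m hx
    · refine (pageMk_eq_zero_iff x).trans (Iff.trans ?_ (mk_eq_zero_iff_mem _).symm)
      change _ ↔ x.1 ∈ FClt C p n
      -- For `r = 0` both summands of the denominator come from `F_{p-1}`, because `p + r - 1 = p -
      -- 1`.
      rw [hC.FClt_eq, mem_pageB]
      constructor
      · rintro ⟨a, ha, b, hb, hab⟩
        rw [← hab]
        refine add_mem (mem_pageZ.1 ha).1 (FCle_d C _ _ _ ?_)
        have := (mem_pageZ.1 hb).1
        rwa [add_zero] at this
      · intro hx
        refine ⟨x.1, mem_pageZ.2 ⟨hx, fun m => ?_⟩, 0, AddSubgroup.zero_mem _, by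
          rw [map_zero, add_zero]⟩
        exact filtration_le hF.mono (by omega) m (FCle_d C _ n m hx)
  choose φ hφ using hex
  refine ⟨φ, hφ, fun n m e => ?_⟩
  obtain ⟨x, rfl⟩ := pageMk_surjective e
  rw [pageD_pageMk, hφ, hφ]
  rfl

theorem IsIntegral.MCMkHom_eq_zero_iff (hC : IsIntegral C) {p : ℤ} {m : ℕ} (x : FCle C p m) :
    MCMkHom C p m x = 0 ↔ ∃ a ∈ FCfil C (p - 1) m, ∃ b ∈ FCdeg C m, a + b = x.1 := by
  rw [← hC.FClt_eq, ← AddSubgroup.mem_sup]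
  exact mk_eq_zero_iff_mem x

/-- `E^1` is magnitude homology. -/
theorem IsIntegral.exists_pageOne_equiv (hC : IsIntegral C) (p : ℤ) (n : ℕ) :
    ∃ φ : E C 1 p n ≃+ MH C p n, ∀ x : pageZ (FC C) (FCfil C) 1 p n,
      ∃ z : (MC C p).cycles n, ((MC C p).iCycles n).hom z = MCMk C ⟨x.1, x.2.1⟩ ∧
        φ (pageMk _ _ x) = ((MC C p).homologyπ n).hom z := by
  let ι : pageZ (FC C) (FCfil C) 1 p n →+ FCle C p n := AddSubgroup.inclusion inf_le_left
  have hcyc : ∀ x, MCMkHom C p n (ι x) ∈ (MC C p).cycleSubgroup n := by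
    refine fun x => ChainComplex.mem_cycleSubgroup.2 fun m => ?_
    rw [d_MCMkHom, hC.MCMkHom_eq_zero_iff]
    exact ⟨_, (mem_pageZ.1 x.2).2 m, 0, AddSubgroup.zero_mem _, add_zero _⟩
  let g : pageZ (FC C) (FCfil C) 1 p n →+ MH C p n := ((MC C p).homologyClass n).comp
    (((MCMkHom C p n).comp ι).codRestrict _ hcyc)
  refine Exists.elim (exists_addEquiv_of_ker_eq (pageMkHom (FC C) (FCfil C) 1 p n) g
    pageMk_surjective ?_ fun x => ?_) fun φ hφ => ⟨φ, fun x => ?_⟩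
  · intro e
    obtain ⟨⟨y, hy⟩, rfl⟩ := (MC C p).homologyClass_surjective n e
    obtain ⟨x, rfl⟩ := MCMkHom_surjective C p n y
    -- A lift `x` of a cycle has boundary in `F_{p-1}` only up to degenerate chains. Normalizing
    -- removes the degenerate part of the boundary and changes `x` by a degenerate chain, hence not
    -- its class in `MC`.
    have hZ : normalize C n x.1 ∈ pageZ (FC C) (FCfil C) 1 p n := by
      refine mem_pageZ.2 ⟨normalize_mem_FCle C x.2, fun m => ?_⟩
      have h := ChainComplex.mem_cycleSubgroup.1 hy m
      rw [d_MCMkHom, hC.MCMkHom_eq_zero_iff] at h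
      obtain ⟨a, ha, b, hb, hab⟩ := h
      rw [normalize_d, ← show a + b = ((FC C).d n m).hom x.1 from hab, map_add,
        normalize_of_mem_FCdeg C hb, add_zero]
      exact normalize_mem_FCle C ha
    refine ⟨⟨_, hZ⟩, congrArg ((MC C p).homologyClass n) (Subtype.ext ?_)⟩
    refine sub_eq_zero.1 ((map_sub (MCMkHom C p n) _ _).symm.trans
      ((hC.MCMkHom_eq_zero_iff _).2 ⟨0, AddSubgroup.zero_mem _, _,
        neg_mem (sub_normalize_mem_FCdeg C x.1), ?_⟩))
    rw [zero_add, neg_sub]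
    rfl
  · refine (pageMk_eq_zero_iff x).trans
      (Iff.trans ?_ (((MC C p).homologyClass_eq_zero_iff _).symm))
    have hx := mem_pageZ.1 x.2
    rw [mem_pageB]
    constructor
    · rintro ⟨a, ha, b, hb, hab⟩
      have hb1 : b ∈ FCfil C p (n + 1) := by
        have := (mem_pageZ.1 hb).1
        rwa [add_sub_cancel_right] at this
      refine ⟨MCMkHom C p (n + 1) ⟨b, hb1⟩, (d_MCMkHom C p _ _ _).trans (sub_eq_zero.1
        ((map_sub (MCMkHom C p n) _ (ι x)).symm.trans ((hC.MCMkHom_eq_zero_iff _).2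
          ⟨-a, neg_mem (mem_pageZ.1 ha).1, 0, AddSubgroup.zero_mem _, ?_⟩)))⟩
      change -a + 0 = ((FC C).d (n + 1) n).hom b - x.1
      rw [← hab]
      abel
    · rintro ⟨y, hy⟩
      obtain ⟨y, rfl⟩ := MCMkHom_surjective C p (n + 1) y
      obtain ⟨a, ha, b, hb, hab⟩ := (hC.MCMkHom_eq_zero_iff _).1
        ((map_sub (MCMkHom C p n) (ι x) ⟨_, FCle_d C p _ _ y.2⟩).trans (sub_eq_zero.2 hy.symm))
      -- As `∂x ∈ F_{p-1}`, the chains `x` and `normalize x` agree modulo `F_{p-1} + ∂F_p`, the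
      -- denominator of `E^1`. Normalizing `x = a + b + ∂y` then eliminates the degenerate `b`.
      obtain ⟨s, hs, t, ht, hst⟩ := exists_eq_normalize_add C hx.1 hx.2
      have hnx : normalize C n x.1 = normalize C n a +
          ((FC C).d (n + 1) n).hom (normalize C (n + 1) y.1) := by
        have h1 : x.1 = a + b + ((FC C).d (n + 1) n).hom y.1 := sub_eq_iff_eq_add.1 hab.symm
        rw [h1, map_add, map_add, normalize_of_mem_FCdeg C hb, add_zero, normalize_d]
      refine ⟨normalize C n a + t, mem_pageZ.2 ⟨add_mem (normalize_mem_FCle C ha) ht,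
        fun m => ?_⟩, normalize C (n + 1) y.1 + s, mem_pageZ.2 ⟨?_, fun m => ?_⟩, ?_⟩
      · rw [sub_self, sub_zero]
        exact FCle_d C _ _ _ (add_mem (normalize_mem_FCle C ha) ht)
      · rw [add_sub_cancel_right]
        exact add_mem (normalize_mem_FCle C y.2) hs
      · rw [sub_self, sub_zero, add_sub_cancel_right]
        exact FCle_d C _ _ _ (add_mem (normalize_mem_FCle C y.2) hs)
      · rw [hst, hnx, map_add]
        abel
  · obtain ⟨z, hz, h⟩ := (MC C p).exists_homologyClass_eq ⟨_, hcyc x⟩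
    exact ⟨z, hz, (hφ x).trans h⟩

end FsetCategory

/-! ### Spans of simplices -/

theorem mem_chainSpan_iff {X : SSet.{w}} {n : ℕ} {S : Set (X _⦋n⦌)}
    {x : (simplicialChains.obj X).X n} :
    x ∈ chainSpan S ↔ ∀ s, (show X _⦋n⦌ →₀ ℤ from x) s ≠ 0 → s ∈ S := by
  constructor
  · intro hx s
    contrapose!
    intro hs
    let ev : (simplicialChains.obj X).X n →+ ℤ := (Finsupp.applyAddHom s : (X _⦋n⦌ →₀ ℤ) →+ ℤ)
    have h : chainSpan S ≤ ev.ker := by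
      refine (AddSubgroup.closure_le _).2 ?_
      rintro _ ⟨t, ht, rfl⟩
      exact Finsupp.single_eq_of_ne fun h => hs (h ▸ ht)
    exact h hx
  · intro h
    let y : X _⦋n⦌ →₀ ℤ := x
    have hy : x = ∑ s ∈ y.support, y s • simplexChain s := by
      refine Eq.trans (b := y.sum Finsupp.single) y.sum_single.symm ?_
      refine Finset.sum_congr rfl fun s _ => ?_
      refine Eq.trans (b := y s • (Finsupp.single s 1 : X _⦋n⦌ →₀ ℤ)) ?_ rfl
      simp
    rw [hy]
    exact sum_mem fun s hs => zsmul_mem (AddSubgroup.subset_closure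
      (Set.mem_image_of_mem _ (h s (Finsupp.mem_support_iff.1 hs)))) _

/-! ### Simplicial maps and spans of simplices -/

section Map

variable {X Y : SSet.{w}} (f : X ⟶ Y) {n : ℕ}

theorem simplicialChains_map_simplexChain (s : X _⦋n⦌) :
    ((simplicialChains.map f).f n).hom (simplexChain s) = simplexChain (f.app _ s) :=
  Finsupp.mapDomain_single

theorem simplicialChains_map_mem {S : Set (X _⦋n⦌)} {T : Set (Y _⦋n⦌)}
    (h : ∀ s ∈ S, f.app _ s ∈ T) {x : (simplicialChains.obj X).X n} (hx : x ∈ chainSpan S) :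
    ((simplicialChains.map f).f n).hom x ∈ chainSpan T := by
  revert x
  change chainSpan S ≤ (chainSpan T).comap ((simplicialChains.map f).f n).hom
  refine (AddSubgroup.closure_le _).2 ?_
  rintro _ ⟨s, hs, rfl⟩
  refine (congrArg (· ∈ chainSpan T) (simplicialChains_map_simplexChain f s)).mpr ?_
  exact AddSubgroup.subset_closure (Set.mem_image_of_mem _ (h s hs))

theorem exists_simplicialChains_map_eq {S : Set (X _⦋n⦌)} {T : Set (Y _⦋n⦌)}
    (h : ∀ t ∈ T, ∃ s ∈ S, f.app _ s = t) {y : (simplicialChains.obj Y).X n}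
    (hy : y ∈ chainSpan T) :
    ∃ x ∈ chainSpan S, ((simplicialChains.map f).f n).hom x = y := by
  revert y
  change chainSpan T ≤ (chainSpan S).map ((simplicialChains.map f).f n).hom
  refine (AddSubgroup.closure_le _).2 ?_
  rintro _ ⟨t, ht, rfl⟩
  obtain ⟨s, hs, rfl⟩ := h t ht
  exact ⟨_, AddSubgroup.subset_closure (Set.mem_image_of_mem _ hs),
    simplicialChains_map_simplexChain f s⟩

/-- Injectivity excludes cancellation: the coefficient of `s` in `x` is that of its image in the
image of `x`. -/
theorem mem_chainSpan_of_map_mem {S : Set (X _⦋n⦌)} {T : Set (Y _⦋n⦌)}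
    (hf : Function.Injective (f.app (op ⦋n⦌))) (h : ∀ s, f.app _ s ∈ T → s ∈ S)
    {x : (simplicialChains.obj X).X n}
    (hx : ((simplicialChains.map f).f n).hom x ∈ chainSpan T) : x ∈ chainSpan S := by
  rw [mem_chainSpan_iff] at hx ⊢
  intro s hs
  refine h s (hx _ fun h0 => hs ?_)
  exact (Finsupp.mapDomain_apply hf (show X _⦋n⦌ →₀ ℤ from x) s).symm.trans h0

end Map

/-! ### Strings of vertices of a digraph -/

namespace Digraph

variable {V : Type u} (G : Digraph V)

theorem exists_hasWalk_of_pathDist_le {a b : V} {k : ℕ} (h : G.pathDist a b ≤ k) :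
    ∃ m ≤ k, G.HasWalk m a b := by
  have h1 : G.pathDist a b < ((k + 1 : ℕ) : ℕ∞) := h.trans_lt (by exact_mod_cast Nat.lt_succ_self k)
  unfold pathDist at h1
  simp only [iInf_lt_iff] at h1
  obtain ⟨m, hm, h2⟩ := h1
  have h3 : m < k + 1 := by exact_mod_cast h2
  exact ⟨m, by omega, hm⟩

variable {G} in
theorem HasWalk.eq {a b : V} (h : G.HasWalk 0 a b) : a = b := by
  obtain ⟨x, rfl, rfl, -⟩ := h
  rfl

variable {G} in
theorem HasWalk.adj {a b : V} (h : G.HasWalk 1 a b) : G.Adj a b := by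
  obtain ⟨x, rfl, rfl, h⟩ := h
  exact h 0 Nat.one_pos

theorem pathDist_le_of_mem_fil {a b : G.Cat} {f : a ⟶ b} {k : ℕ}
    (h : f ∈ FsetCategory.fil a b (k : ℝ≥0)) : G.pathDist a.vertex b.vertex ≤ k := by
  have h1 : ((G.pathDist a.vertex b.vertex : ℕ∞) : ℝ≥0∞) ≤ (((k : ℝ≥0)) : ℝ≥0∞) := h
  have h2 : (((k : ℝ≥0)) : ℝ≥0∞) = ((k : ℕ∞) : ℝ≥0∞) := by simp
  rw [h2] at h1
  exact_mod_cast h1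

theorem mem_fil_of_pathDist_le {a b : G.Cat} {f : a ⟶ b} {k : ℕ}
    (h : G.pathDist a.vertex b.vertex ≤ k) : f ∈ FsetCategory.fil a b (k : ℝ≥0) := by
  have h2 : (((k : ℝ≥0)) : ℝ≥0∞) = ((k : ℕ∞) : ℝ≥0∞) := by simp
  change ((G.pathDist a.vertex b.vertex : ℕ∞) : ℝ≥0∞) ≤ (((k : ℝ≥0)) : ℝ≥0∞)
  rw [h2]
  exact_mod_cast h

/-- The sequence of vertices of a string of morphisms. -/
def vertices {n : ℕ} (s : ComposableArrows G.Cat n) : (tuples V) _⦋n⦌ :=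
  G.vertexMap.app (op ⦋n⦌) s

theorem vertices_injective (n : ℕ) :
    Function.Injective (G.vertexMap.app (op ⦋n⦌)) := by
  intro s t h
  have hobj : ∀ i, (show ComposableArrows G.Cat n from s).obj i =
      (show ComposableArrows G.Cat n from t).obj i := by
    intro i
    have := congrFun (show (fun i => ((show ComposableArrows G.Cat n from s).obj i).vertex) =
      fun i => ((show ComposableArrows G.Cat n from t).obj i).vertex from h) i
    exact congrArg Cat.mk this
  exact CategoryTheory.Functor.ext hobj fun _ _ _ => rfl

/-- If a vertex is repeated, omitting one copy and doubling the other restores the vertices, hence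
the string, since a string is determined by its vertices. -/
theorem vertices_mem_irregularTuples_iff {n : ℕ} (s : (nerve G.Cat) _⦋n⦌) :
    G.vertexMap.app _ s ∈ irregularTuples V n ↔ s ∈ (nerve G.Cat).degenerate n := by
  rw [irregularTuples_eq_degenerate]
  refine ⟨fun h => ?_, fun h => SSet.degenerate_app_apply h _⟩
  obtain _ | n := n
  · simp at h
  rw [SSet.degenerate_eq_iUnion_range_σ, Set.mem_iUnion] at h
  obtain ⟨i, t, ht⟩ := h
  have hs : (nerve G.Cat).σ i ((nerve G.Cat).δ i.castSucc s) = s := by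
    refine G.vertices_injective (n + 1) ?_
    have h1 : G.vertexMap.app _ ((nerve G.Cat).σ i ((nerve G.Cat).δ i.castSucc s)) =
      (tuples V).σ i ((tuples V).δ i.castSucc (G.vertexMap.app _ s)) := rfl
    rw [h1, ← ht, SSet.δ_comp_σ_self_apply]
  rw [← hs]
  exact SSet.σ_mem_degenerate _ _ _

/-- A string of `n` morphisms of total degree at most `n` is irregular or allowed. -/
theorem vertices_mem_of_inFil {n : ℕ} {s : ComposableArrows G.Cat n}
    (h : FsetCategory.InFil s (n : ℝ)) (hirr : G.vertices s ∉ irregularTuples V n) :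
    G.vertices s ∈ G.allowedTuples n := by
  choose k hk using fun i : Fin n =>
    G.isIntegral_cat _ _ (s.map (homOfLE i.castSucc_le_succ))
  have hne : ∀ i : Fin n, tupleEntry (G.vertices s) i.castSucc ≠ tupleEntry (G.vertices s) i.succ :=
    fun i hi => hirr ⟨i, hi⟩
  have hwalk : ∀ i : Fin n, ∃ m ≤ k i,
      G.HasWalk m (tupleEntry (G.vertices s) i.castSucc) (tupleEntry (G.vertices s) i.succ) :=
    fun i => G.exists_hasWalk_of_pathDist_le (G.pathDist_le_of_mem_fil (hk i).1)
  have hpos : ∀ i, 1 ≤ k i := by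
    intro i
    by_contra hi
    obtain ⟨m, hm, hw⟩ := hwalk i
    obtain rfl : m = 0 := by omega
    exact hne i hw.eq
  rw [FsetCategory.InFil.of_hasDegree hk] at h
  have hsum : ∑ i, k i ≤ ∑ i : Fin n, 1 := by
    have : ∑ i, k i ≤ n := by exact_mod_cast h
    simpa using this
  -- `n` positive integers with sum at most `n` are all equal to `1`.
  have heq : ∀ i ∈ Finset.univ, 1 = k i :=
    (Finset.sum_eq_sum_iff_of_le fun i _ => hpos i).1
      (le_antisymm (Finset.sum_le_sum fun i _ => hpos i) hsum)
  intro i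
  obtain ⟨m, hm, hw⟩ := hwalk i
  rw [← heq i (Finset.mem_univ i)] at hm
  obtain rfl | rfl : m = 0 ∨ m = 1 := by omega
  · exact absurd hw.eq (hne i)
  · exact hw.adj

/-- A string of `n` morphisms of total degree less than `n` is irregular. -/
theorem vertices_mem_irregularTuples_of_inFil {n : ℕ} {s : ComposableArrows G.Cat n} {ℓ : ℝ}
    (h : FsetCategory.InFil s ℓ) (hℓ : ℓ < n) : G.vertices s ∈ irregularTuples V n := by
  by_contra hirr
  choose k hk using fun i : Fin n =>
    G.isIntegral_cat _ _ (s.map (homOfLE i.castSucc_le_succ))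
  have hpos : ∀ i, 1 ≤ k i := by
    intro i
    by_contra hi
    obtain ⟨m, hm, hw⟩ := G.exists_hasWalk_of_pathDist_le (G.pathDist_le_of_mem_fil (hk i).1)
    obtain rfl : m = 0 := by omega
    exact hirr ⟨i, hw.eq⟩
  rw [FsetCategory.InFil.of_hasDegree hk] at h
  have h1 : ∑ i, k i < n := by exact_mod_cast h.trans_lt hℓ
  have h2 : ∑ i : Fin n, 1 ≤ ∑ i, k i := Finset.sum_le_sum fun i _ => hpos i
  simp only [Finset.sum_const, Finset.card_univ, Fintype.card_fin, smul_eq_mul, mul_one] at h2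
  omega

/-- The stretch of `x` from `i` to `j` is itself a walk; `Fin.ofNat` wraps around only at indices
beyond it. -/
theorem pathDist_le_of_mem_allowedTuples {n : ℕ} {x : (tuples V) _⦋n⦌}
    (hx : x ∈ G.allowedTuples n) {i j : Fin (n + 1)} (h : i ≤ j) :
    G.pathDist (tupleEntry x i) (tupleEntry x j) ≤ ((j - i : ℕ) : ℕ∞) := by
  refine iInf₂_le_of_le _ ⟨fun t => tupleEntry x (Fin.ofNat (n + 1) (i + t)), ?_, ?_, ?_⟩ le_rfl
  · refine congrArg (tupleEntry x) (Fin.ext ?_)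
    rw [Fin.val_ofNat, Nat.mod_eq_of_lt (by omega), add_zero]
  · refine congrArg (tupleEntry x) (Fin.ext ?_)
    have : (i : ℕ) ≤ j := h
    rw [Fin.val_ofNat, Nat.mod_eq_of_lt (by omega)]
    omega
  · intro t ht
    have hj := j.isLt
    have e := hx ⟨i + t, by omega⟩
    have e1 : Fin.ofNat (n + 1) (i + t) = (⟨i + t, by omega⟩ : Fin n).castSucc := by
      refine Fin.ext ?_
      rw [Fin.val_ofNat, Nat.mod_eq_of_lt (by omega)]
      rfl
    have e2 : Fin.ofNat (n + 1) (i + (t + 1)) = (⟨i + t, by omega⟩ : Fin n).succ := by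
      refine Fin.ext ?_
      rw [Fin.val_ofNat, Nat.mod_eq_of_lt (by omega)]
      rfl
    dsimp only
    rw [e1, e2]
    exact e

/-- An allowed sequence of `n + 1` vertices is a string of `n` morphisms of degree `1`. -/
theorem exists_inFil_vertices_eq {n : ℕ} {x : (tuples V) _⦋n⦌} (hx : x ∈ G.allowedTuples n) :
    ∃ s : ComposableArrows G.Cat n, FsetCategory.InFil s (n : ℝ) ∧ G.vertices s = x := by
  let s : ComposableArrows G.Cat n :=
    { obj := fun i => ⟨tupleEntry x i⟩
      map := fun f => ⟨ne_top_of_le_ne_top (ENat.natCast_ne_top _)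
        (G.pathDist_le_of_mem_allowedTuples hx (leOfHom f))⟩
      map_id := fun _ => rfl
      map_comp := fun _ _ => rfl }
  refine ⟨s, ⟨fun _ => ((1 : ℕ) : ℝ≥0), fun i => G.mem_fil_of_pathDist_le ?_, by simp⟩, rfl⟩
  have h := G.pathDist_le_of_mem_allowedTuples hx i.castSucc_le_succ
  rwa [Fin.val_succ, Fin.val_castSucc, Nat.add_sub_cancel_left] at h

end Digraph

namespace Digraph

open FsetCategory

variable {V : Type u} (G : Digraph V)

/-! ### Path homology as a page of the spectral sequence -/

theorem vertexChainMap_d (m n : ℕ) (x : (FC G.Cat).X m) :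
    ((simplicialChains.obj (tuples V)).d m n).hom (G.vertexChainMap m x) =
      G.vertexChainMap n (((FC G.Cat).d m n).hom x) :=
  congrArg (fun f => AddCommGrpCat.Hom.hom f x) ((simplicialChains.map G.vertexMap).comm m n)

theorem vertexChainMap_mem_irregularPaths_iff {n : ℕ} (x : (FC G.Cat).X n) :
    G.vertexChainMap n x ∈ irregularPaths V n ↔ x ∈ FCdeg G.Cat n :=
  ⟨fun h => mem_chainSpan_of_map_mem G.vertexMap (G.vertices_injective n)
      (fun s => (G.vertices_mem_irregularTuples_iff s).1) h,
    fun h => simplicialChains_map_mem G.vertexMap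
      (fun s => (G.vertices_mem_irregularTuples_iff s).2) h⟩

/-- A nondegenerate string of `n` morphisms has total degree at least `n`. Equivalently, `MC^ℓ_n`
vanishes for `n > ℓ`. -/
theorem mem_FCdeg_of_lt {n : ℕ} {ℓ : ℝ} (hℓ : ℓ < n) {x : (FC G.Cat).X n}
    (hx : x ∈ FCle G.Cat ℓ n) : x ∈ FCdeg G.Cat n :=
  AddSubgroup.closure_mono (Set.image_mono fun s hs =>
    (G.vertices_mem_irregularTuples_iff s).1 (G.vertices_mem_irregularTuples_of_inFil hs hℓ)) hx

theorem vertexChainMap_mem_allowedPaths {n : ℕ} {x : (FC G.Cat).X n}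
    (hx : x ∈ FCle G.Cat n n) : G.vertexChainMap n x ∈ G.allowedPaths n := by
  have h : G.vertexChainMap n x ∈ chainSpan (G.allowedTuples n ∪ irregularTuples V n) :=
    simplicialChains_map_mem G.vertexMap (fun s hs => by
      by_cases hirr : G.vertices s ∈ irregularTuples V n
      · exact Or.inr hirr
      · exact Or.inl (G.vertices_mem_of_inFil hs hirr)) hx
  unfold chainSpan at h
  rwa [Set.image_union, AddSubgroup.closure_union] at h

/-- Every allowed path is the image of a chain in `F_n`, up to irregular paths. -/
theorem exists_vertexChainMap_eq {n : ℕ} {y : (simplicialChains.obj (tuples V)).X n}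
    (hy : y ∈ G.allowedPaths n) :
    ∃ x ∈ FCle G.Cat n n, y - G.vertexChainMap n x ∈ irregularPaths V n := by
  obtain ⟨a, ha, b, hb, rfl⟩ := AddSubgroup.mem_sup.1 hy
  obtain ⟨x, hx, rfl⟩ := exists_simplicialChains_map_eq G.vertexMap
    (S := {s | InFil (C := G.Cat) (n := n) s n}) (fun t ht => G.exists_inFil_vertices_eq ht) ha
  exact ⟨x, hx, (congrArg (· ∈ irregularPaths V n) (add_sub_cancel_left _ _)).mpr hb⟩

theorem FCfil_natCast (n : ℕ) : FCfil G.Cat (n : ℤ) n = FCle G.Cat n n :=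
  congrArg (fun ℓ => FCle G.Cat ℓ n) (Int.cast_natCast n)

theorem mem_invariantPaths {n : ℕ} {y : (simplicialChains.obj (tuples V)).X n} :
    y ∈ G.invariantPaths n ↔ y ∈ G.allowedPaths n ∧
      ∀ m, ((simplicialChains.obj (tuples V)).d n m).hom y ∈ G.allowedPaths m := by
  simp [invariantPaths, AddSubgroup.mem_inf, AddSubgroup.mem_iInf]

/-- The boundary has chain degree `p - 1` but filtration degree `p - 2`, too small for a
nondegenerate string. -/
theorem vertexChainMap_d_mem_irregularPaths {p : ℕ} {x : (FC G.Cat).X p}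
    (hx : x ∈ pageZ (FC G.Cat) (FCfil G.Cat) 2 p p) (m : ℕ) :
    ((simplicialChains.obj (tuples V)).d p m).hom (G.vertexChainMap p x) ∈
      irregularPaths V m := by
  rw [vertexChainMap_d, vertexChainMap_mem_irregularPaths_iff]
  by_cases hm : m + 1 = p
  · refine G.mem_FCdeg_of_lt ?_ ((mem_pageZ.1 hx).2 m)
    rw [← hm]
    push_cast
    linarith
  · rw [(FC G.Cat).d_apply_eq_zero_of_ne hm]
    exact AddSubgroup.zero_mem _

theorem vertexChainMap_mem_invariantPaths {p : ℕ} {x : (FC G.Cat).X p}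
    (hx : x ∈ pageZ (FC G.Cat) (FCfil G.Cat) 2 p p) :
    G.vertexChainMap p x ∈ G.invariantPaths p := by
  refine G.mem_invariantPaths.2 ⟨G.vertexChainMap_mem_allowedPaths ?_, fun m =>
    AddSubgroup.mem_sup_right (G.vertexChainMap_d_mem_irregularPaths hx m)⟩
  rw [← FCfil_natCast]
  exact (mem_pageZ.1 hx).1

/-- Every invariant path whose boundary is irregular comes from `Z^2_p`. -/
theorem exists_mem_pageZ_two {p : ℕ} {y : (simplicialChains.obj (tuples V)).X p}
    (hy : y ∈ G.invariantPaths p)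
    (hd : ∀ m, ((simplicialChains.obj (tuples V)).d p m).hom y ∈ irregularPaths V m) :
    ∃ x ∈ pageZ (FC G.Cat) (FCfil G.Cat) 2 p p,
      G.vertexChainMap p x - y ∈ irregularPaths V p := by
  obtain ⟨x, hx, hxy⟩ := G.exists_vertexChainMap_eq (G.mem_invariantPaths.1 hy).1
  -- The lift `x` has degenerate boundary, so its normalization is an honest cycle.
  refine ⟨normalize G.Cat p x, mem_pageZ.2 ⟨?_, fun m => ?_⟩, ?_⟩
  · rw [FCfil_natCast]
    exact normalize_mem_FCle _ hx
  · have h1 : ((FC G.Cat).d p m).hom x ∈ FCdeg G.Cat m := by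
      rw [← vertexChainMap_mem_irregularPaths_iff, ← vertexChainMap_d]
      have h2 := sub_mem (hd m) (irregularPaths_d V p m hxy)
      rwa [map_sub, sub_sub_cancel] at h2
    rw [normalize_d, normalize_of_mem_FCdeg _ h1]
    exact AddSubgroup.zero_mem _
  · have h1 := (G.vertexChainMap_mem_irregularPaths_iff _).2 (sub_normalize_mem_FCdeg G.Cat x)
    rw [map_sub] at h1
    have h2 := neg_mem (add_mem h1 hxy)
    refine (congrArg (· ∈ irregularPaths V p) ?_).mpr h2
    abel

/-- In the denominator of `E^2`, the summand `Z^1_{p-1}` is degenerate in chain degree `p`, and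
`Z^1_{p+1}` maps to `Ω_{p+1}` because its boundaries lie in `F_p`. Conversely, normalizing a lift of
`w` turns an equality modulo irregular paths into one of chains. -/
theorem mem_pageB_two_iff {p : ℕ} {x : (FC G.Cat).X p}
    (hx : x ∈ pageZ (FC G.Cat) (FCfil G.Cat) 2 p p) :
    x ∈ pageB (FC G.Cat) (FCfil G.Cat) 2 p p ↔ ∃ w ∈ G.invariantPaths (p + 1),
      ((simplicialChains.obj (tuples V)).d (p + 1) p).hom w - G.vertexChainMap p x ∈
        irregularPaths V p := by
  have hmono := (isConvergentFiltration G.Cat).mono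
  have hcast : (p : ℤ) + 2 - 1 = ((p + 1 : ℕ) : ℤ) := by push_cast; ring
  have hx' := mem_pageZ.1 hx
  rw [mem_pageB]
  constructor
  · rintro ⟨a, ha, b, hb, rfl⟩
    have hb' := mem_pageZ_succ.1 hb
    refine ⟨G.vertexChainMap (p + 1) b, G.mem_invariantPaths.2 ⟨?_, fun m => ?_⟩, ?_⟩
    · refine G.vertexChainMap_mem_allowedPaths ?_
      rw [← FCfil_natCast, ← hcast]
      exact hb'.1
    · rw [vertexChainMap_d]
      by_cases hm : m = p
      · subst hm
        refine G.vertexChainMap_mem_allowedPaths ?_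
        rw [← FCfil_natCast]
        exact filtration_le hmono (by omega) _ hb'.2
      · rw [(FC G.Cat).d_apply_eq_zero_of_ne (by omega), map_zero]
        exact AddSubgroup.zero_mem _
    · rw [vertexChainMap_d, ← map_sub, vertexChainMap_mem_irregularPaths_iff,
        sub_add_cancel_right]
      refine neg_mem (G.mem_FCdeg_of_lt ?_ (mem_pageZ.1 ha).1)
      push_cast
      linarith
  · rintro ⟨w, hw, h⟩
    obtain ⟨y, hy, hwy⟩ := G.exists_vertexChainMap_eq (G.mem_invariantPaths.1 hw).1
    have h1 : ((FC G.Cat).d (p + 1) p).hom y - x ∈ FCdeg G.Cat p := by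
      rw [← vertexChainMap_mem_irregularPaths_iff, map_sub, ← vertexChainMap_d]
      have h2 := sub_mem h (irregularPaths_d V _ p hwy)
      rwa [map_sub, sub_sub_sub_cancel_left] at h2
    have hnx : normalize G.Cat p x = ((FC G.Cat).d (p + 1) p).hom (normalize G.Cat (p + 1) y) := by
      rw [normalize_d]
      refine (sub_eq_zero.1 ?_).symm
      rw [← map_sub]
      exact normalize_of_mem_FCdeg _ h1
    -- Here `s ∈ F_p` and `t ∈ F_{p-2}`, so that `x = t + ∂(normalize y + s)` has the required form.
    obtain ⟨s, hs, t, ht, hst⟩ := exists_eq_normalize_add G.Cat hx'.1 hx'.2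
    refine ⟨t, mem_pageZ.2 ⟨filtration_le hmono (by omega) _ ht, fun m =>
      filtration_le hmono (by omega) _ (FCle_d _ _ _ _ ht)⟩, normalize G.Cat (p + 1) y + s,
      mem_pageZ_succ.2 ⟨add_mem ?_ (filtration_le hmono (by omega) _ hs), ?_⟩, ?_⟩
    · rw [hcast, FCfil_natCast]
      exact normalize_mem_FCle _ hy
    · rw [map_add, ← hnx]
      refine filtration_le hmono (by omega : (p : ℤ) ≤ _) _ (add_mem ?_ (FCle_d _ _ _ _ hs))
      exact normalize_mem_FCle _ hx'.1
    · rw [map_add, ← hnx]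
      nth_rw 2 [hst]
      abel

/-- The quotient map onto `Ω_n`. -/
def pathMkHom (n : ℕ) : G.invariantPaths n →+ G.pathComplex.X n :=
  QuotientAddGroup.mk' ((irregularPaths V n).addSubgroupOf (G.invariantPaths n))

theorem pathMkHom_surjective (n : ℕ) : Function.Surjective (G.pathMkHom n) :=
  QuotientAddGroup.mk_surjective

theorem pathMkHom_eq_zero_iff {n : ℕ} (x : G.invariantPaths n) :
    G.pathMkHom n x = 0 ↔ x.1 ∈ irregularPaths V n :=
  mk_eq_zero_iff_mem x

theorem d_pathMkHom (m n : ℕ) (x : G.invariantPaths m) :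
    (G.pathComplex.d m n).hom (G.pathMkHom m x) = G.pathMkHom n
      ⟨((simplicialChains.obj (tuples V)).d m n).hom x.1, G.invariantPaths_d m n x.2⟩ :=
  rfl

/-- The map `Z^2_p → Ω_p`. -/
def pageZToPath (p : ℕ) : pageZ (FC G.Cat) (FCfil G.Cat) 2 p p →+ G.pathComplex.X p :=
  (G.pathMkHom p).comp (((G.vertexChainMap p).comp (AddSubgroup.subtype _)).codRestrict _
    fun x => G.vertexChainMap_mem_invariantPaths x.2)

theorem pageZToPath_mem_cycleSubgroup {p : ℕ} (x : pageZ (FC G.Cat) (FCfil G.Cat) 2 p p) :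
    G.pageZToPath p x ∈ G.pathComplex.cycleSubgroup p :=
  ChainComplex.mem_cycleSubgroup.2 fun m => (G.d_pathMkHom p m _).trans
    ((G.pathMkHom_eq_zero_iff _).2 (G.vertexChainMap_d_mem_irregularPaths x.2 m))

theorem exists_pageZToPath_eq {p : ℕ} {y : G.pathComplex.X p}
    (hy : y ∈ G.pathComplex.cycleSubgroup p) : ∃ x, G.pageZToPath p x = y := by
  obtain ⟨y, rfl⟩ := G.pathMkHom_surjective p y
  obtain ⟨x, hx, hxy⟩ := G.exists_mem_pageZ_two y.2 fun m => by
    have h := ChainComplex.mem_cycleSubgroup.1 hy m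
    rwa [d_pathMkHom, pathMkHom_eq_zero_iff] at h
  exact ⟨⟨x, hx⟩, sub_eq_zero.1 ((map_sub (G.pathMkHom p) _ y).symm.trans
    ((G.pathMkHom_eq_zero_iff _).2 hxy))⟩

theorem pageMk_two_eq_zero_iff {p : ℕ} (x : pageZ (FC G.Cat) (FCfil G.Cat) 2 p p) :
    pageMk _ _ x = 0 ↔
      ∃ w : G.pathComplex.X (p + 1), (G.pathComplex.d (p + 1) p).hom w = G.pageZToPath p x := by
  rw [pageMk_eq_zero_iff, G.mem_pageB_two_iff x.2]
  have key : ∀ w : G.invariantPaths (p + 1),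
      (G.pathComplex.d (p + 1) p).hom (G.pathMkHom (p + 1) w) = G.pageZToPath p x ↔
      ((simplicialChains.obj (tuples V)).d (p + 1) p).hom w.1 - G.vertexChainMap p x.1 ∈
        irregularPaths V p := by
    intro w
    rw [d_pathMkHom, ← sub_eq_zero]
    exact (Eq.congr_left (map_sub (G.pathMkHom p) _ _).symm).trans (G.pathMkHom_eq_zero_iff _)
  constructor
  · rintro ⟨w, hw, h⟩
    exact ⟨_, (key ⟨w, hw⟩).2 h⟩
  · rintro ⟨w, h⟩
    obtain ⟨w, rfl⟩ := G.pathMkHom_surjective (p + 1) w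
    exact ⟨w.1, w.2, (key w).1 h⟩

/-- `E^2_{p,0}` is path homology. -/
theorem exists_pageTwo_equiv (p : ℕ) :
    ∃ φ : E G.Cat 2 p p ≃+ G.pathHomology p,
      ∀ x : pageZ (FC G.Cat) (FCfil G.Cat) 2 p p,
        ∃ (y : G.invariantPaths p) (z : G.pathComplex.cycles p),
          y.1 = G.vertexChainMap p x.1 ∧ (G.pathComplex.iCycles p).hom z = G.pathMk y ∧
          φ (pageMk _ _ x) = (G.pathComplex.homologyπ p).hom z := by
  let c := (G.pageZToPath p).codRestrict _ G.pageZToPath_mem_cycleSubgroup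
  refine Exists.elim (exists_addEquiv_of_ker_eq (pageMkHom (FC G.Cat) (FCfil G.Cat) 2 p p)
    ((G.pathComplex.homologyClass p).comp c) pageMk_surjective ?_ fun x => ?_) fun φ hφ =>
      ⟨φ, fun x => ?_⟩
  · refine (G.pathComplex.homologyClass_surjective p).comp fun y => ?_
    obtain ⟨x, hx⟩ := G.exists_pageZToPath_eq y.2
    exact ⟨x, Subtype.ext hx⟩
  · exact (G.pageMk_two_eq_zero_iff x).trans (G.pathComplex.homologyClass_eq_zero_iff (c x)).symm
  · obtain ⟨z, hz, h⟩ := G.pathComplex.exists_homologyClass_eq (c x)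
    exact ⟨⟨_, G.vertexChainMap_mem_invariantPaths x.2⟩, z, rfl, hz, (hφ x).trans h⟩

/-! ### Reduced path homology -/

/-- The augmented complex `0 ← ℤ ← Ω_0 ← Ω_1 ← ⋯`. -/
abbrev augmentedPathComplex : ChainComplex AddCommGrpCat.{u} ℕ :=
  G.pathComplex.augment G.pathAugmentation G.d_pathAugmentation

theorem mem_augmentedPathComplex_cycleSubgroup_iff {k : ℕ} (x : G.pathComplex.X (k + 1)) :
    (show G.augmentedPathComplex.X (k + 2) from x) ∈ G.augmentedPathComplex.cycleSubgroup (k + 2) ↔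
      x ∈ G.pathComplex.cycleSubgroup (k + 1) := by
  rw [ChainComplex.mem_cycleSubgroup, ChainComplex.mem_cycleSubgroup]
  refine ⟨fun h m => h (m + 1), fun h m => ?_⟩
  obtain _ | m := m
  · exact G.augmentedPathComplex.d_apply_eq_zero_of_ne (by omega) _
  · exact h m

/-- The augmentation starts at `Ω_0`, so for `p ≥ 1` the cycles and boundaries at `Ω_p` are those of
the path complex, shifted by one degree. -/
theorem exists_reducedPathHomology_equiv {p : ℕ} (hp : 1 ≤ p) :
    Nonempty (E G.Cat 2 p p ≃+ G.reducedPathHomology p) := by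
  obtain ⟨k, rfl⟩ : ∃ k, p = k + 1 := ⟨p - 1, by omega⟩
  obtain ⟨φ, -⟩ := G.exists_pageTwo_equiv (k + 1)
  let ι : G.pathComplex.cycleSubgroup (k + 1) →+ G.augmentedPathComplex.cycleSubgroup (k + 2) :=
    (AddSubgroup.subtype (G.pathComplex.cycleSubgroup (k + 1))).codRestrict
      (G.augmentedPathComplex.cycleSubgroup (k + 2))
      fun x => (G.mem_augmentedPathComplex_cycleSubgroup_iff x.1).2 x.2
  have hι : Function.Surjective ι := fun y =>
    ⟨⟨y.1, (G.mem_augmentedPathComplex_cycleSubgroup_iff y.1).1 y.2⟩, rfl⟩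
  obtain ⟨ψ, -⟩ := exists_addEquiv_of_ker_eq (G.pathComplex.homologyClass (k + 1))
    ((G.augmentedPathComplex.homologyClass (k + 2)).comp ι)
    (G.pathComplex.homologyClass_surjective _)
    ((G.augmentedPathComplex.homologyClass_surjective _).comp hι) fun x =>
      (G.pathComplex.homologyClass_eq_zero_iff x).trans
        (G.augmentedPathComplex.homologyClass_eq_zero_iff (ι x)).symm
  exact ⟨φ.trans ψ⟩

/-- The augmentation of `E^2_{0,0}`, whose kernel is the reduced path homology in degree `0`. -/
theorem exists_pageTwo_augmentation :
    ∃ ε : E G.Cat 2 0 0 →+ ULift.{u} ℤ,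
      (∀ x : pageZ (FC G.Cat) (FCfil G.Cat) 2 0 0,
        ε (pageMk _ _ x) = coeffSum V (G.vertexChainMap 0 x.1)) ∧
      Nonempty (G.reducedPathHomology 0 ≃+ ε.ker) := by
  -- The index is the cast of a natural number, as in the general lemmas; it is definitionally the
  -- integer `0`.
  let ε₀ : pageZ (FC G.Cat) (FCfil G.Cat) 2 (0 : ℕ) 0 →+ ULift.{u} ℤ :=
    G.pathAugmentation.hom.comp (G.pageZToPath 0)
  have hε₀ : ∀ x, pageMk (FC G.Cat) (FCfil G.Cat) x = 0 → ε₀ x = 0 := by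
    intro x hx
    obtain ⟨w, hw⟩ := (G.pageMk_two_eq_zero_iff x).1 hx
    change G.pathAugmentation.hom (G.pageZToPath 0 x) = 0
    rw [← hw]
    exact congrArg (fun f => AddCommGrpCat.Hom.hom f w) G.d_pathAugmentation
  let ε : E G.Cat 2 (0 : ℕ) 0 →+ ULift.{u} ℤ := QuotientAddGroup.lift _ ε₀ fun x hx =>
    hε₀ x ((pageMk_eq_zero_iff x).2 (AddSubgroup.mem_addSubgroupOf.1 hx))
  refine ⟨ε, fun x => rfl, ?_⟩
  let f : ε₀.ker →+ ε.ker :=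
    ((pageMkHom _ _ _ _ _).comp (AddSubgroup.subtype _)).codRestrict _ fun x => x.2
  have hcyc : ∀ x : ε₀.ker, (show G.augmentedPathComplex.X 1 from G.pageZToPath 0 x.1) ∈
      G.augmentedPathComplex.cycleSubgroup 1 := by
    refine fun x => ChainComplex.mem_cycleSubgroup.2 fun m => ?_
    -- The differential of the augmented complex from degree `1` to degree `0` is the augmentation,
    -- which vanishes on `x`.
    obtain _ | m := m
    · exact x.2
    · exact G.augmentedPathComplex.d_apply_eq_zero_of_ne (by omega) _
  let c : ε₀.ker →+ G.augmentedPathComplex.cycleSubgroup 1 :=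
    ((G.pageZToPath 0).comp (AddSubgroup.subtype _)).codRestrict
      (G.augmentedPathComplex.cycleSubgroup 1) hcyc
  have hf : Function.Surjective f := by
    rintro ⟨e, he⟩
    obtain ⟨x, rfl⟩ := pageMk_surjective e
    exact ⟨⟨x, he⟩, rfl⟩
  have hc : Function.Surjective c := by
    rintro ⟨y, hy⟩
    -- Every element of `Ω_0` is a cycle of the path complex, so it lifts to `Z^2_0`.
    obtain ⟨x, hx⟩ := G.exists_pageZToPath_eq (p := 0) (y := y)
      (ChainComplex.mem_cycleSubgroup.2 fun m =>
        G.pathComplex.d_apply_eq_zero_of_ne (by omega) _)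
    refine ⟨⟨x, ?_⟩, Subtype.ext hx⟩
    refine (congrArg G.pathAugmentation.hom hx).trans ?_
    exact ChainComplex.mem_cycleSubgroup.1 hy 0
  obtain ⟨ψ, -⟩ := exists_addEquiv_of_ker_eq
    ((G.augmentedPathComplex.homologyClass 1).comp c) f
    ((G.augmentedPathComplex.homologyClass_surjective _).comp hc) hf fun x => by
      refine (G.augmentedPathComplex.homologyClass_eq_zero_iff (c x)).trans ?_
      refine (G.pageMk_two_eq_zero_iff x.1).symm.trans ?_
      exact (Subtype.ext_iff (a1 := f x) (a2 := 0)).symm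
  exact ⟨ψ⟩

end Digraph

/-- A string of `n` morphisms has total degree at most `n * M`, so any `N ≥ (n + 1) * M` works.
Degree `n + 1` is included because the incoming differentials start there. -/
theorem FsetCategory.HasBoundedDegrees.exists_eq_top {C : Type u} [FsetCategory.{u, v} C]
    (hC : FsetCategory.HasBoundedDegrees C) (n : ℕ) :
    ∃ N : ℕ, FsetCategory.FCfil C N n = ⊤ ∧ FsetCategory.FCfil C N (n + 1) = ⊤ := by
  obtain ⟨M, hM⟩ := hC
  obtain ⟨N, hN⟩ := exists_nat_ge (((n + 1 : ℕ) : ℝ) * M)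
  refine ⟨N, FsetCategory.FCle_eq_top_of_bound hM (le_trans ?_ (hN.trans (by simp))),
    FsetCategory.FCle_eq_top_of_bound hM (hN.trans (by simp))⟩
  push_cast
  nlinarith [M.coe_nonneg]

end

theorem mainTheorem3 :
    (∀ (C : Type u) [FsetCategory.{u, v} C], FsetCategory.IsIntegral C →
      -- the pages form a spectral sequence
      (∀ (r : ℕ) (p : ℤ) (n : ℕ),
        NextPageIsHomology (FsetCategory.FC C) (FsetCategory.FCfil C) r p n) ∧
      -- (1) `E^0`, with its differential, is the un-normalized magnitude chain complex
      (∀ p : ℤ, ∃ φ : ∀ n : ℕ, FsetCategory.E C 0 p n ≃+ (FsetCategory.unnormalizedMC C p).X n,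
        (∀ (n : ℕ) (x : pageZ (FsetCategory.FC C) (FsetCategory.FCfil C) 0 p n),
          φ n (pageMk _ _ x) = FsetCategory.unnormalizedMCMk C ⟨x.1, x.2.1⟩) ∧
        ∀ (n m : ℕ) (e : FsetCategory.E C 0 p n),
          φ m (pageD (FsetCategory.FC C) (FsetCategory.FCfil C) 0 (add_zero p) n m e) =
            ((FsetCategory.unnormalizedMC C p).d n m).hom (φ n e)) ∧
      -- (1) `E^1` is magnitude homology
      (∀ (p : ℤ) (n : ℕ), ∃ φ : FsetCategory.E C 1 p n ≃+ FsetCategory.MH C p n,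
        ∀ x : pageZ (FsetCategory.FC C) (FsetCategory.FCfil C) 1 p n,
          ∃ z : (FsetCategory.MC C p).cycles n,
            ((FsetCategory.MC C p).iCycles n).hom z = FsetCategory.MCMk C ⟨x.1, x.2.1⟩ ∧
            φ (pageMk _ _ x) = ((FsetCategory.MC C p).homologyπ n).hom z) ∧
      -- (3) the filtration of the homology is bounded below and exhaustive, and `E^∞` is its
      -- associated graded
      (∀ n : ℕ,
        (∀ p : ℤ, p < 0 → homologyFil (FsetCategory.FC C) (FsetCategory.FCfil C) p n = ⊥) ∧
        (∀ h : FsetCategory.underlyingHomology C n,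
          ∃ p : ℤ, h ∈ homologyFil (FsetCategory.FC C) (FsetCategory.FCfil C) p n) ∧
        ∀ p : ℤ, PageInfIsGr (FsetCategory.FC C) (FsetCategory.FCfil C) p n) ∧
      -- (3) a term that is constant from the page `r₀` on is the associated graded
      (∀ (r₀ : ℕ) (p : ℤ) (n : ℕ),
        StableFrom (FsetCategory.FC C) (FsetCategory.FCfil C) r₀ p n →
        ∀ r : ℕ, r₀ ≤ r → PageIsGr (FsetCategory.FC C) (FsetCategory.FCfil C) r p n) ∧
      -- (3) if the degrees are bounded, all terms of a given total degree are constant from some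
      -- page on, and the filtration of the homology is finite
      (FsetCategory.HasBoundedDegrees C → ∀ n : ℕ,
        (∃ p : ℤ, homologyFil (FsetCategory.FC C) (FsetCategory.FCfil C) p n = ⊤) ∧
        ∃ r₀ : ℕ, ∀ p : ℤ,
          StableFrom (FsetCategory.FC C) (FsetCategory.FCfil C) r₀ p n ∧
          ∀ r : ℕ, r₀ ≤ r → PageIsGr (FsetCategory.FC C) (FsetCategory.FCfil C) r p n)) ∧
    -- (2) digraphs
    (∀ (V : Type w) (G : Digraph V), (∀ a, ¬ G.Adj a a) →
      -- `E^2_{p,0}` is path homology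
      (∀ p : ℕ, ∃ φ : FsetCategory.E G.Cat 2 p p ≃+ G.pathHomology p,
        ∀ x : pageZ (FsetCategory.FC G.Cat) (FsetCategory.FCfil G.Cat) 2 p p,
          ∃ (y : G.invariantPaths p) (z : G.pathComplex.cycles p),
            y.1 = G.vertexChainMap p x.1 ∧ (G.pathComplex.iCycles p).hom z = G.pathMk y ∧
            φ (pageMk _ _ x) = (G.pathComplex.homologyπ p).hom z) ∧
      -- which is reduced path homology for `p ≥ 1`
      (∀ p : ℕ, 1 ≤ p → Nonempty (FsetCategory.E G.Cat 2 p p ≃+ G.reducedPathHomology p)) ∧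
      -- while for `p = 0` the latter is the kernel of the augmentation of `E^2_{0,0}`
      ∃ ε : FsetCategory.E G.Cat 2 0 0 →+ ULift.{w} ℤ,
        (∀ x : pageZ (FsetCategory.FC G.Cat) (FsetCategory.FCfil G.Cat) 2 0 0,
          ε (pageMk _ _ x) = Digraph.coeffSum V (G.vertexChainMap 0 x.1)) ∧
        Nonempty (G.reducedPathHomology 0 ≃+ ε.ker)) := by
  refine ⟨fun C _ hC => ?_, fun V G _ => ⟨G.exists_pageTwo_equiv,
    fun p hp => G.exists_reducedPathHomology_equiv hp, G.exists_pageTwo_augmentation⟩⟩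
  have hF := FsetCategory.isConvergentFiltration C
  refine ⟨nextPageIsHomology hF.mono, hC.exists_pageZero_equiv, hC.exists_pageOne_equiv,
    fun n => ⟨fun p hp => homologyFil_eq_bot hF hp n, exists_mem_homologyFil hF,
      fun p => pageInfIsGr hF p n⟩,
    fun r₀ p n hst r hr => pageIsGr_of_stableFrom hF hst r hr, fun hb n => ?_⟩
  obtain ⟨N, h₀, h₁⟩ := hb.exists_eq_top n
  refine ⟨⟨N, eq_top_iff.2 fun h _ => ?_⟩, N + 1, fun p => ?_⟩
  · obtain ⟨z, rfl⟩ := ChainComplex.homologyπ_surjective _ n h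
    refine ⟨z, ?_, rfl⟩
    rw [h₀]
    exact AddSubgroup.mem_top _
  · have hst := stableFrom_of_eq_top hF h₀ h₁ p
    exact ⟨hst, fun r hr => pageIsGr_of_stableFrom hF hst r hr⟩
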